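/- Let $H$ be a complex Hilbert space and let $A$ be a positive self-adjoint operator in $H$ with compact inverse. Let $\{e_n\}_{n\ge1}$ be an orthonormal basis of $H$ with $Ae_n=a_ne_n$ and $1\le a_1\le a_2\le\cdots$ (eigenvalues counted with multiplicity). Let $\theta\in[0,1]$, let $c_k>0$ and $0<\gamma_1<\gamma_2<\cdots$ satisfy $$\sum_{k=1}^\infty \frac{c_k}{\gamma_k}<1,\qquad c_k=\frac{\mathcal A}{k^{\alpha}}+O\Big(\frac1{k^{\alpha+1}}\Big),\qquad \gamma_k=\mathcal B k^{\beta}+O(k^{\beta-1})\quad(k\to\infty),$$ with constants $\mathcal A>0$, $\mathcal B>0$, $0<\alpha\le 1$, $\alpha+\beta>1$, $\beta>1/2$. For $\lambda\in\mathbb C\setminus P$, where $P=\{-\gamma_k : k\ge1\}$, put $$\widehat K(\lambda)=\sum_{k=1}^\infty\frac{c_k}{\lambda+\gamma_k},\qquad L(\lambda)=\lambda^2I+A^2-\widehat K(\lambda)A^{2\theta},\qquad \ell_n(\lambda)=(L(\lambda)e_n,e_n)=\lambda^2+a_n^2\Big(1-\frac{1}{a_n^{2(1-\theta)}}\widehat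 K(\lambda)\Big),$$ where $A^{2\theta}x=\sum_n a_n^{2\theta}(x,e_n)e_n$ and $L(\lambda)$ has the domain $\operatorname{Dom}(A^2)\cap \operatorname{Dom}(A^{2\theta})$. Let $\sigma(L)$ be the complement in $\mathbb C$ of the set of all $\lambda\in\mathbb C\setminus P$ for which $L(\lambda)$ has an everywhere defined bounded inverse; thus $P\subset\sigma(L)$. Then there are real numbers $\lambda_{n,k}$ ($n,k\ge1$) and complex numbers $\lambda_n^{+},\lambda_n^{-}$ ($n\ge1$) such that for every $n$ the set of zeros of $\ell_n$ in $\mathbb C\setminus P$ is $\{\lambda_{n,k}: k\ge1\}\cup\{\lambda_n^+,\lambda_n^-\}$, with $$\cdots<-\gamma_{k}<\lambda_{n,k}<-\gamma_{k-1}<\cdots<-\gamma_1<\lambda_{n,1}<0,$$ such that $\lim_{n\to\infty}\lambda_{n,k}=-\gamma_k$ for every $k$ if $\theta<1$, such that for all sufficiently large $n$ the pair is non-real and complex-conjugate, $\operatorname{Im}\lambda_n^+>0$ and $\lambda_n^-=\overline{\lambda_n^+}$, and such that, if $\theta<1$, $$\sigma(L)=\overline{\Big(\bigcup_{n=1}^\infty\bigcup_{k=1}^\infty\{\lambda_{n,k}\}\Big)\cup\Big(\bigcup_{n=1}^\infty\{\lambda_n^+,\lambda_n^-\}\Big)}.$$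 If $\theta=1$, the same equality holds with $\sigma(L)\setminus P$ in place of $\sigma(L)$, that is, when the poles of $\widehat K$, at which $L$ is not defined, are left out. -/

import Mathlib

open Filter Topology

noncomputable section

namespace GurtinPipkin

variable {H : Type*} [NormedAddCommGroup H] [InnerProductSpace ℂ H]

/-- `T` is the everywhere defined bounded inverse of the (possibly unbounded) operator `B`. -/
def IsBoundedInverse (B : H →ₗ.[ℂ] H) (T : H →L[ℂ] H) : Prop :=
  (∀ x : B.domain, T (B x) = x) ∧ ∀ y : H, ∃ h : T y ∈ B.domain, B ⟨T y, h⟩ = y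

/-- The natural domain `{x ∈ D(A) : A x ∈ D(A)}` of `A²`. -/
def sqDomain (A : H →ₗ.[ℂ] H) : Submodule ℂ H :=
  (A.domain.comap A.toFun).map A.domain.subtype

/-- The square `A² = A ∘ A` of an unbounded operator, on its natural domain. -/
def sqOp (A : H →ₗ.[ℂ] H) : H →ₗ.[ℂ] H :=
  A.comp (A.domRestrict (sqDomain A)) (by
    rintro ⟨x, hx⟩
    obtain ⟨y, hy, rfl⟩ := hx.1
    have h : A.domRestrict (sqDomain A) ⟨_, hx⟩ = A y := LinearPMap.domRestrict_apply rfl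
    rw [h]
    exact hy)

/-- The sequence of coordinates `aₙ^s (x, eₙ)`, where `(x, eₙ) = e.repr x n`. -/
def powCoord (e : HilbertBasis ℕ ℂ H) (a : ℕ → ℝ) (s : ℝ) (x : H) : ℕ → ℂ :=
  fun n => ((a n ^ s : ℝ) : ℂ) * e.repr x n

theorem powCoord_add (e : HilbertBasis ℕ ℂ H) (a : ℕ → ℝ) (s : ℝ) (x y : H) :
    powCoord e a s (x + y) = powCoord e a s x + powCoord e a s y := by
  funext n
  simp [powCoord, mul_add]

theorem powCoord_smul (e : HilbertBasis ℕ ℂ H) (a : ℕ → ℝ) (s : ℝ) (z : ℂ) (x : H) :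
    powCoord e a s (z • x) = z • powCoord e a s x := by
  funext n
  simp only [powCoord, map_smul, lp.coeFn_smul, Pi.smul_apply, smul_eq_mul]
  ring

/-- The domain `{x : ∑ₙ |aₙ^s (x, eₙ)|² < ∞}` of `A^s`. -/
def powDomain (e : HilbertBasis ℕ ℂ H) (a : ℕ → ℝ) (s : ℝ) : Submodule ℂ H where
  carrier := {x | Memℓp (powCoord e a s x) 2}
  add_mem' := by
    intro x y hx hy
    rw [Set.mem_ofPred_eq, powCoord_add]
    exact Memℓp.add hx hy
  zero_mem' := by
    have h : powCoord e a s (0 : H) = 0 := by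
      funext n
      simp [powCoord]
    rw [Set.mem_ofPred_eq, h]
    exact zero_memℓp
  smul_mem' := by
    intro z x hx
    rw [Set.mem_ofPred_eq, powCoord_smul]
    exact Memℓp.const_smul hx z

/-- The power `A^s x = ∑ₙ aₙ^s (x, eₙ) eₙ` of the positive self-adjoint operator `A` which has
the orthonormal eigenbasis `e` and the eigenvalues `a`. -/
def powOp (e : HilbertBasis ℕ ℂ H) (a : ℕ → ℝ) (s : ℝ) : H →ₗ.[ℂ] H where
  domain := powDomain e a s
  toFun :=
    { toFun := fun x => e.repr.symm ⟨powCoord e a s x, x.2⟩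
      map_add' := by
        intro x y
        rw [← map_add]
        exact congrArg e.repr.symm (Subtype.ext (powCoord_add e a s x y))
      map_smul' := by
        intro z x
        rw [RingHom.id_apply, ← map_smul]
        exact congrArg e.repr.symm (Subtype.ext (powCoord_smul e a s z x)) }

/-- The Laplace transform `K̂(lam) = ∑ₖ cₖ / (lam + γₖ)` of the kernel
`K(t) = ∑ₖ cₖ exp (-γₖ t)`. It has a genuine meaning only off the poles `-γₖ`. -/
def kernelHat (c γ : ℕ → ℝ) (lam : ℂ) : ℂ := ∑' k, (c k : ℂ) / (lam + (γ k : ℂ))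

/-- The set of poles `-γₖ` of `K̂`; the symbol is not defined there. -/
def poles (γ : ℕ → ℝ) : Set ℂ := Set.range fun k => -(γ k : ℂ)

/-- The symbol `L(lam) = lam² I + A² - K̂(lam) A^{2θ}`; the domain of the sum is
`D(A²) ∩ D(A^{2θ})`. -/
def symbol (A : H →ₗ.[ℂ] H) (e : HilbertBasis ℕ ℂ H) (a c γ : ℕ → ℝ) (θ : ℝ) (lam : ℂ) :
    H →ₗ.[ℂ] H :=
  (lam ^ 2 • (LinearMap.id : H →ₗ[ℂ] H)) +ᵥ
    (sqOp A - kernelHat c γ lam • powOp e a (2 * θ))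

/-- The resolvent set: the complex numbers `lam` at which `L(lam)` is defined and has a
bounded inverse. -/
def symbolResolventSet (A : H →ₗ.[ℂ] H) (e : HilbertBasis ℕ ℂ H) (a c γ : ℕ → ℝ) (θ : ℝ) :
    Set ℂ :=
  {lam | lam ∉ poles γ ∧ ∃ T : H →L[ℂ] H, IsBoundedInverse (symbol A e a c γ θ lam) T}

/-- The spectrum `σ(L)`: the complement of the resolvent set in the complex plane. -/
def symbolSpectrum (A : H →ₗ.[ℂ] H) (e : HilbertBasis ℕ ℂ H) (a c γ : ℕ → ℝ) (θ : ℝ) :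
    Set ℂ :=
  (symbolResolventSet A e a c γ θ)ᶜ

/-- The meromorphic function
`ℓₙ(lam) = lam² + aₙ² (1 - aₙ^{-2(1-θ)} ∑ₖ cₖ / (lam + γₖ))`. -/
def ell (a c γ : ℕ → ℝ) (θ : ℝ) (n : ℕ) (lam : ℂ) : ℂ :=
  lam ^ 2 + (a n : ℂ) ^ 2 * (1 - 1 / ((a n ^ (2 * (1 - θ)) : ℝ) : ℂ) * kernelHat c γ lam)

/-- The set of zeros of the meromorphic function `ℓₙ`. -/
def ellZeros (a c γ : ℕ → ℝ) (θ : ℝ) (n : ℕ) : Set ℂ :=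
  {lam | lam ∉ poles γ ∧ ell a c γ θ n lam = 0}

end GurtinPipkin

end

/-! In the basis `e` the operator L(λ) is multiplication by ℓₙ(λ) = λ² + s(1 - κK̂(λ)), with s = aₙ²
and 0 < κ = aₙ^{-2(1-θ)} ≤ 1, so everything reduces to scalar functions of this form.

Zeros. K̂ runs to +∞ and -∞ at the two sides of each pole and K̂(0) < 1, so the intermediate value
theorem puts a zero in every gap (`exists_zero_in_gap`). There are at most two more: a third divided
difference kills λ² + s, so four distinct zeros wᵢ satisfy ∑ cₖ/∏ᵢ(wᵢ + γₖ) = 0. This is absurd if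
the wᵢ form two pairs, each conjugate or real in a common gap, since all terms are then positive
(`not_four_zeros`). For large aₙ a quantitative open mapping argument near i·aₙ, where K̂ is small,
yields a non-real zero.

Spectrum. Off the poles, ℓₙ/aₙ² tends to 1 - lK̂ with l = lim κ, locally uniformly. Where this limit
is nonzero and no ℓₙ vanishes, |ℓₙ| ≥ δaₙ²; this makes L invertible and keeps zeros from
accumulating. For θ < 1, l = 0 and the limit is 1; each pole is the limit of the zeros in its gap.
For θ = 1, l = 1: where K̂ = 1, L is a scalar on an unbounded operator's domain, hence not
invertible, and by strict monotonicity of K̂ the point is a limit of zeros. The poles are then not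
limits of zeros, because at a zero K̂ = 1 + λ²/aₙ² stays bounded. -/

namespace GurtinPipkin

/-! ### The kernel: convergence, holomorphy, behaviour at the poles -/

/-- Nonnegative weights at points increasing to infinity, with `∑ c k / γ k` convergent. -/
structure IsAdmissible (c γ : ℕ → ℝ) : Prop where
  nonneg : ∀ k, 0 ≤ c k
  pos : ∀ k, 0 < γ k
  strictMono : StrictMono γ
  tendsto : Tendsto γ atTop atTop
  summable : Summable fun k => c k / γ k

/-- The restriction of `kernelHat` to the real axis. -/
noncomputable def kernelReal (c γ : ℕ → ℝ) (x : ℝ) : ℝ := ∑' k, c k / (x + γ k)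

theorem notMem_poles {γ : ℕ → ℝ} {z : ℂ} : z ∉ poles γ ↔ ∀ k, z + (γ k : ℂ) ≠ 0 := by
  simp only [poles, Set.mem_range, not_exists, ne_eq, eq_comm, eq_neg_iff_add_eq_zero]

theorem ofReal_notMem_poles {γ : ℕ → ℝ} {x : ℝ} : (x : ℂ) ∉ poles γ ↔ ∀ k, x + γ k ≠ 0 := by
  rw [notMem_poles]
  exact forall_congr' fun k => by rw [← Complex.ofReal_add, Complex.ofReal_ne_zero]

theorem notMem_poles_of_im_ne_zero {γ : ℕ → ℝ} {z : ℂ} (hz : z.im ≠ 0) : z ∉ poles γ := by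
  rintro ⟨k, rfl⟩
  simp at hz

theorem kernelHat_ofReal (c γ : ℕ → ℝ) (x : ℝ) :
    kernelHat c γ (x : ℂ) = (kernelReal c γ x : ℂ) := by
  simp [kernelHat, kernelReal, Complex.ofReal_tsum]

theorem kernelHat_conj (c γ : ℕ → ℝ) (z : ℂ) :
    kernelHat c γ ((starRingEnd ℂ) z) = (starRingEnd ℂ) (kernelHat c γ z) := by
  simp [kernelHat, Complex.conj_tsum]

/-- A positive sequence that is eventually bounded away from zero is bounded away from zero. -/
theorem exists_pos_forall_le {u : ℕ → ℝ} {d : ℝ} (hd : 0 < d) (hu : ∀ k, 0 < u k)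
    (h : ∀ᶠ k in atTop, d ≤ u k) : ∃ δ > 0, ∀ k, δ ≤ u k := by
  obtain ⟨N, hN⟩ := eventually_atTop.1 h
  obtain ⟨m, -, hm⟩ := Finset.exists_min_image (Finset.range (N + 1)) u ⟨0, by simp⟩
  refine ⟨min d (u m), lt_min hd (hu m), fun k => ?_⟩
  rcases le_total N k with hk | hk
  · exact (min_le_left _ _).trans (hN k hk)
  · exact (min_le_right _ _).trans (hm k (by simpa [Nat.lt_succ_iff] using hk))

namespace IsAdmissible

variable {c γ : ℕ → ℝ} (h : IsAdmissible c γ)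
include h

/-- Removing one weight leaves a function regular at -γₖ, so K̂ splits there into a pole term and a
continuous rest. For this reason admissible weights may vanish. -/
theorem update (k : ℕ) : IsAdmissible (Function.update c k 0) γ where
  nonneg j := by
    rcases eq_or_ne j k with rfl | hj
    · simp
    · simpa [hj] using h.nonneg j
  pos := h.pos
  strictMono := h.strictMono
  tendsto := h.tendsto
  summable := by
    refine Summable.of_nonneg_of_le (fun j => ?_) (fun j => ?_) h.summable
    · rcases eq_or_ne j k with rfl | hj
      · simp
      · simpa [hj] using div_nonneg (h.nonneg j) (h.pos j).le
    · rcases eq_or_ne j k with rfl | hj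
      · simpa using div_nonneg (h.nonneg j) (h.pos j).le
      · simp [hj]

theorem exists_norm_add_ge {z : ℂ} :
    ∃ δ > 0, ∀ k, z + (γ k : ℂ) ≠ 0 → δ * γ k ≤ ‖z + γ k‖ := by
  classical
  obtain ⟨δ, hδ, hle⟩ := exists_pos_forall_le
    (u := fun k => if z + (γ k : ℂ) = 0 then 1 else ‖z + γ k‖ / γ k) (d := 1 / 2) (by norm_num)
    (fun k => by
      split_ifs with hk
      · exact one_pos
      · exact div_pos (norm_pos_iff.2 hk) (h.pos k))
    (by
      filter_upwards [h.tendsto.eventually_ge_atTop (2 * ‖z‖)] with k hk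
      split_ifs
      · norm_num
      · rw [le_div_iff₀ (h.pos k)]
        have h1 : ‖(γ k : ℂ)‖ ≤ ‖z + γ k‖ + ‖z‖ := by
          simpa using norm_sub_le (z + (γ k : ℂ)) z
        rw [Complex.norm_of_nonneg (h.pos k).le] at h1
        linarith)
  refine ⟨δ, hδ, fun k hk => ?_⟩
  have := hle k
  rwa [if_neg hk, le_div_iff₀ (h.pos k)] at this

/-- Near a point where no term of `kernelHat` is singular, the terms have a summable bound. -/
theorem exists_ball_bound {z : ℂ} (hz : ∀ k, c k = 0 ∨ z + (γ k : ℂ) ≠ 0) :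
    ∃ r > 0, ∃ C > 0, ∀ w ∈ Metric.ball z r, ∀ k,
      (c k = 0 ∨ w + (γ k : ℂ) ≠ 0) ∧ ‖(c k : ℂ) / (w + γ k)‖ ≤ C * (c k / γ k) := by
  obtain ⟨δ, hδ, hle⟩ := h.exists_norm_add_ge (z := z)
  -- The radius is at most δγₖ/2 for every k, so moving from z to w costs at most half of the lower
  -- bound δγₖ.
  refine ⟨δ * γ 0 / 2, by have := h.pos 0; positivity, 2 / δ, by positivity, fun w hw k => ?_⟩
  rcases hz k with hk | hk
  · simp [hk]
  have h0 := h.strictMono.monotone (Nat.zero_le k)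
  have h1 := hle k hk
  have h2 : ‖z + (γ k : ℂ)‖ ≤ ‖w + γ k‖ + ‖w - z‖ := by
    rw [norm_sub_rev]
    have h5 : z + (γ k : ℂ) = (w + γ k) + (z - w) := by ring
    rw [h5]
    exact norm_add_le _ _
  rw [Metric.mem_ball, dist_eq_norm] at hw
  have hγk := h.pos k
  have h3 : δ / 2 * γ k ≤ ‖w + γ k‖ := by nlinarith
  have h4 : 0 < δ / 2 * γ k := by positivity
  refine ⟨Or.inr (norm_pos_iff.1 (h4.trans_le h3)), ?_⟩
  rw [norm_div, Complex.norm_of_nonneg (h.nonneg k)]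
  calc c k / ‖w + γ k‖ ≤ c k / (δ / 2 * γ k) := div_le_div_of_nonneg_left (h.nonneg k) h4 h3
    _ = 2 / δ * (c k / γ k) := by field_simp

theorem summable_of_regular {z : ℂ} (hz : ∀ k, c k = 0 ∨ z + (γ k : ℂ) ≠ 0) :
    Summable fun k => (c k : ℂ) / (z + γ k) := by
  obtain ⟨r, hr, C, -, hb⟩ := h.exists_ball_bound hz
  exact Summable.of_norm_bounded (h.summable.mul_left C)
    fun k => (hb z (Metric.mem_ball_self hr) k).2

theorem differentiableAt_of_regular {z : ℂ} (hz : ∀ k, c k = 0 ∨ z + (γ k : ℂ) ≠ 0) :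
    DifferentiableAt ℂ (kernelHat c γ) z := by
  obtain ⟨r, hr, C, -, hb⟩ := h.exists_ball_bound hz
  refine DifferentiableOn.differentiableAt (s := Metric.ball z r) ?_ (Metric.ball_mem_nhds z hr)
  refine Complex.differentiableOn_tsum_of_summable_norm (h.summable.mul_left C) (fun k w hw => ?_)
    Metric.isOpen_ball fun k w hw => (hb w hw k).2
  rcases (hb w hw k).1 with hk | hk
  · simp only [hk, Complex.ofReal_zero, zero_div]
    exact differentiableWithinAt_const _
  · have hd : DifferentiableAt ℂ (fun v : ℂ => (c k : ℂ) / (v + γ k)) w :=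
      DifferentiableAt.div (by fun_prop) (by fun_prop) hk
    exact hd.differentiableWithinAt

theorem hasSum {z : ℂ} (hz : z ∉ poles γ) :
    HasSum (fun k => (c k : ℂ) / (z + γ k)) (kernelHat c γ z) :=
  (h.summable_of_regular fun k => Or.inr (notMem_poles.1 hz k)).hasSum

theorem differentiableAt {z : ℂ} (hz : z ∉ poles γ) : DifferentiableAt ℂ (kernelHat c γ) z :=
  h.differentiableAt_of_regular fun k => Or.inr (notMem_poles.1 hz k)

theorem hasSum_real {x : ℝ} (hx : ∀ k, x + γ k ≠ 0) :
    HasSum (fun k => c k / (x + γ k)) (kernelReal c γ x) := by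
  have := h.hasSum (ofReal_notMem_poles.2 hx)
  rw [kernelHat_ofReal] at this
  exact_mod_cast this

theorem continuousAt_real {x : ℝ} (hx : ∀ k, c k = 0 ∨ x + γ k ≠ 0) :
    ContinuousAt (kernelReal c γ) x := by
  have h1 : ContinuousAt (fun y : ℝ => (kernelHat c γ (y : ℂ)).re) x :=
    Complex.continuous_re.continuousAt.comp
      (ContinuousAt.comp (f := ((↑) : ℝ → ℂ)) (h.differentiableAt_of_regular fun k =>
        (hx k).imp_right fun hk => by exact_mod_cast hk).continuousAt
        Complex.continuous_ofReal.continuousAt)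
  simpa [kernelHat_ofReal] using h1

theorem regular_update (k : ℕ) (j : ℕ) :
    Function.update c k 0 j = 0 ∨ (-(γ k : ℂ)) + (γ j : ℂ) ≠ 0 := by
  rcases eq_or_ne j k with rfl | hj
  · simp
  · right
    rw [neg_add_eq_sub, sub_ne_zero]
    exact_mod_cast h.strictMono.injective.ne hj

theorem kernelHat_eq_add {z : ℂ} (hz : z ∉ poles γ) (k : ℕ) :
    kernelHat c γ z = (c k : ℂ) / (z + γ k) + kernelHat (Function.update c k 0) γ z := by
  classical
  rw [kernelHat, (h.hasSum hz).summable.tsum_eq_add_tsum_ite k, kernelHat]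
  congr 2
  ext j
  rcases eq_or_ne j k with rfl | hj <;> simp [*]

theorem kernelReal_eq_add {x : ℝ} (hx : ∀ k, x + γ k ≠ 0) (k : ℕ) :
    kernelReal c γ x = c k / (x + γ k) + kernelReal (Function.update c k 0) γ x := by
  have := h.kernelHat_eq_add (ofReal_notMem_poles.2 hx) k
  simp only [kernelHat_ofReal] at this
  exact_mod_cast this

/-- The open intervals between consecutive poles, and the half-line to the right of all poles. -/
theorem gap_cases {x : ℝ} (hx : ∀ k, x + γ k ≠ 0) :
    ∃ k, -γ k < x ∧ ∀ j < k, x < -γ j := by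
  classical
  have hex : ∃ k, -γ k < x := by
    obtain ⟨k, hk⟩ := (h.tendsto.eventually_gt_atTop (-x)).exists
    exact ⟨k, by linarith⟩
  refine ⟨Nat.find hex, Nat.find_spec hex, fun j hj => ?_⟩
  exact lt_of_le_of_ne (not_lt.1 (Nat.find_min hex hj)) fun he => hx j (by linarith)

/-- The condition over all j < k is vacuous for k = 0, so the half-line to the right of all poles
needs no separate treatment. -/
theorem add_ne_zero_of_gap {x : ℝ} {k : ℕ} (h1 : -γ k < x) (h2 : ∀ j < k, x < -γ j) (j : ℕ) :
    x + γ j ≠ 0 := by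
  rcases lt_or_ge j k with hj | hj
  · have := h2 j hj
    linarith
  · have := h.strictMono.monotone hj
    linarith

theorem mul_pos_of_gap {x y : ℝ} {k : ℕ} (hx1 : -γ k < x) (hx2 : ∀ j < k, x < -γ j)
    (hy1 : -γ k < y) (hy2 : ∀ j < k, y < -γ j) (j : ℕ) : 0 < (x + γ j) * (y + γ j) := by
  rcases lt_or_ge j k with hj | hj
  · have := hx2 j hj
    have := hy2 j hj
    apply mul_pos_of_neg_of_neg <;> linarith
  · have := h.strictMono.monotone hj
    apply mul_pos <;> linarith

theorem tendsto_update (k : ℕ) (s : Set ℝ) :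
    Tendsto (kernelReal (Function.update c k 0) γ) (𝓝[s] (-γ k))
      (𝓝 (kernelReal (Function.update c k 0) γ (-γ k))) :=
  ((h.update k).continuousAt_real fun j => (h.regular_update k j).imp_right
    fun hj => by exact_mod_cast hj).continuousWithinAt

/-- The weights c may vanish and so miss poles. The auxiliary weights γⱼ/2ʲ are all positive and
give a geometric series; with the k-th one removed, regularity near -γₖ excludes every other pole.
-/
theorem eventually_punctured (k : ℕ) : ∀ᶠ z : ℂ in 𝓝[≠] (-(γ k : ℂ)), z ∉ poles γ := by
  obtain ⟨r, hr, C, -, hb⟩ := IsAdmissible.exists_ball_bound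
    (c := Function.update (fun k => γ k / 2 ^ k) k 0) (γ := γ) (z := -(γ k : ℂ))
    (IsAdmissible.update ⟨fun k => by have := h.pos k; positivity, h.pos, h.strictMono, h.tendsto,
      by
        have : (fun k => γ k / 2 ^ k / γ k) = fun k => (1 / 2 : ℝ) ^ k := by
          ext k
          have := h.pos k
          field_simp
          rw [← mul_pow]; norm_num
        rw [this]
        exact summable_geometric_two⟩ k)
    (fun j => by
      rcases eq_or_ne j k with rfl | hj
      · simp
      · right
        rw [neg_add_eq_sub, sub_ne_zero]
        exact_mod_cast h.strictMono.injective.ne hj)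
  filter_upwards [self_mem_nhdsWithin, mem_nhdsWithin_of_mem_nhds (Metric.ball_mem_nhds _ hr)]
    with z hz hzr
  refine notMem_poles.2 fun j => ?_
  rcases eq_or_ne j k with rfl | hj
  · exact fun he => hz (eq_neg_of_add_eq_zero_left he)
  · refine ((hb z hzr j).1).resolve_left ?_
    have := h.pos j
    simp [hj, this.ne']

theorem eventually_punctured_real (k : ℕ) :
    ∀ᶠ x : ℝ in 𝓝[≠] (-γ k), (x : ℂ) ∉ poles γ := by
  have : Tendsto ((↑) : ℝ → ℂ) (𝓝[≠] (-γ k)) (𝓝[≠] (-(γ k : ℂ))) := by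
    refine tendsto_nhdsWithin_iff.2 ⟨?_, ?_⟩
    · simpa using (Complex.continuous_ofReal.tendsto (-γ k)).mono_left nhdsWithin_le_nhds
    · filter_upwards [self_mem_nhdsWithin] with x hx
      rw [Set.mem_compl_iff, Set.mem_singleton_iff]
      exact_mod_cast hx
  exact this.eventually (h.eventually_punctured k)

theorem tendsto_norm_kernelHat {k : ℕ} (hk : 0 < c k) :
    Tendsto (fun z => ‖kernelHat c γ z‖) (𝓝[≠] (-(γ k : ℂ))) atTop := by
  have h1 : Tendsto (fun z : ℂ => (c k : ℂ) / (z + γ k)) (𝓝[≠] (-(γ k : ℂ)))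
      (Bornology.cobounded ℂ) := by
    have h2 : Tendsto (fun z : ℂ => z + γ k) (𝓝[≠] (-(γ k : ℂ))) (𝓝[≠] 0) := by
      refine tendsto_nhdsWithin_iff.2 ⟨?_, ?_⟩
      · have : ContinuousAt (fun z : ℂ => z + γ k) (-(γ k : ℂ)) := by fun_prop
        simpa using this.tendsto.mono_left nhdsWithin_le_nhds
      · filter_upwards [self_mem_nhdsWithin] with z hz he
        exact hz (eq_neg_of_add_eq_zero_left he)
    have h3 := (tendsto_inv₀_nhdsNE_zero (α := ℂ)).comp h2
    have h4 : (c k : ℂ) ≠ 0 := by exact_mod_cast hk.ne'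
    simp only [div_eq_mul_inv]
    rw [← tendsto_norm_atTop_iff_cobounded] at h3 ⊢
    simpa [norm_mul] using h3.const_mul_atTop (norm_pos_iff.2 h4)
  have h5 : Tendsto (kernelHat (Function.update c k 0) γ) (𝓝[≠] (-(γ k : ℂ)))
      (𝓝 (kernelHat (Function.update c k 0) γ (-(γ k : ℂ)))) :=
    ((h.update k).differentiableAt_of_regular
      (h.regular_update k)).continuousAt.tendsto.mono_left nhdsWithin_le_nhds
  rw [← tendsto_norm_atTop_iff_cobounded] at h1
  refine tendsto_atTop_mono' _ ?_ (tendsto_atTop_add_const_right _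
    (-(‖kernelHat (Function.update c k 0) γ (-(γ k : ℂ))‖ + 1)) h1)
  filter_upwards [h.eventually_punctured k,
    h5.norm.eventually (gt_mem_nhds (lt_add_one _))] with z hz hz2
  rw [h.kernelHat_eq_add hz k]
  have := norm_sub_le_norm_add ((c k : ℂ) / (z + γ k)) (kernelHat (Function.update c k 0) γ z)
  linarith

theorem tendsto_kernelReal_right {k : ℕ} (hk : 0 < c k) :
    Tendsto (kernelReal c γ) (𝓝[>] (-γ k)) atTop := by
  have h1 : Tendsto (fun x => c k / (x + γ k)) (𝓝[>] (-γ k)) atTop := by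
    have h2 : Tendsto (fun x => x + γ k) (𝓝[>] (-γ k)) (𝓝[>] 0) := by
      refine tendsto_nhdsWithin_iff.2 ⟨?_, ?_⟩
      · have : ContinuousAt (fun z : ℝ => z + γ k) (-γ k) := by fun_prop
        simpa using this.tendsto.mono_left nhdsWithin_le_nhds
      · filter_upwards [self_mem_nhdsWithin] with z hz
        simpa [neg_lt_iff_pos_add] using hz
    simpa only [div_eq_mul_inv, Function.comp_def] using
      (tendsto_inv_nhdsGT_zero.comp h2).const_mul_atTop hk
  refine (h1.atTop_add (h.tendsto_update k _)).congr' ?_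
  filter_upwards [h.eventually_punctured_real k |>.filter_mono (nhdsWithin_mono _ fun x hx => ne_of_gt hx)]
    with x hx
  rw [h.kernelReal_eq_add (ofReal_notMem_poles.1 hx) k]

theorem tendsto_kernelReal_left {k : ℕ} (hk : 0 < c k) :
    Tendsto (kernelReal c γ) (𝓝[<] (-γ k)) atBot := by
  have h1 : Tendsto (fun x => c k / (x + γ k)) (𝓝[<] (-γ k)) atBot := by
    have h2 : Tendsto (fun x => x + γ k) (𝓝[<] (-γ k)) (𝓝[<] 0) := by
      refine tendsto_nhdsWithin_iff.2 ⟨?_, ?_⟩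
      · have : ContinuousAt (fun z : ℝ => z + γ k) (-γ k) := by fun_prop
        simpa using this.tendsto.mono_left nhdsWithin_le_nhds
      · filter_upwards [self_mem_nhdsWithin] with z hz
        have : z < -γ k := hz
        simp only [Set.mem_Iio]
        linarith
    simpa only [div_eq_mul_inv, Function.comp_def] using
      (tendsto_inv_nhdsLT_zero.comp h2).const_mul_atBot hk
  refine (h1.atBot_add (h.tendsto_update k _)).congr' ?_
  filter_upwards [h.eventually_punctured_real k |>.filter_mono (nhdsWithin_mono _ fun x hx => ne_of_lt hx)]
    with x hx
  rw [h.kernelReal_eq_add (ofReal_notMem_poles.1 hx) k]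

end IsAdmissible

/-! ### Zeros of the scalar symbol -/

/-- The function `z² + s (1 - κ K̂(z))`, of which every `ell` is an instance. -/
noncomputable def scalarSymbol (c γ : ℕ → ℝ) (s κ : ℝ) (z : ℂ) : ℂ :=
  z ^ 2 + s * (1 - κ * kernelHat c γ z)

/-- The zeros of `scalarSymbol` off the poles. -/
def scalarZeros (c γ : ℕ → ℝ) (s κ : ℝ) : Set ℂ :=
  {z | z ∉ poles γ ∧ scalarSymbol c γ s κ z = 0}

theorem conj_mem_scalarZeros {c γ : ℕ → ℝ} {s κ : ℝ} {z : ℂ} (hz : z ∈ scalarZeros c γ s κ) :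
    (starRingEnd ℂ) z ∈ scalarZeros c γ s κ := by
  refine ⟨notMem_poles.2 fun k hk => notMem_poles.1 hz.1 k ?_, ?_⟩
  · have := congrArg (starRingEnd ℂ) hk
    simpa using this
  · have := congrArg (starRingEnd ℂ) hz.2
    simpa [scalarSymbol, kernelHat_conj] using this

theorem scalarSymbol_ofReal (c γ : ℕ → ℝ) (s κ x : ℝ) :
    scalarSymbol c γ s κ (x : ℂ) = ((x ^ 2 + s * (1 - κ * kernelReal c γ x) : ℝ) : ℂ) := by
  simp [scalarSymbol, kernelHat_ofReal]

namespace IsAdmissible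

variable {c γ : ℕ → ℝ} (h : IsAdmissible c γ)
include h

/-- The third divided difference of a function `z² + s (1 - κ K̂(z))` at four of its zeros. -/
theorem hasSum_div_prod {s κ : ℝ} (hs : s ≠ 0) (hκ : κ ≠ 0) {w₁ w₂ w₃ w₄ : ℂ}
    (h₁ : w₁ ∈ scalarZeros c γ s κ) (h₂ : w₂ ∈ scalarZeros c γ s κ)
    (h₃ : w₃ ∈ scalarZeros c γ s κ) (h₄ : w₄ ∈ scalarZeros c γ s κ)
    (h₁₂ : w₁ ≠ w₂) (h₁₃ : w₁ ≠ w₃) (h₁₄ : w₁ ≠ w₄) (h₂₃ : w₂ ≠ w₃) (h₂₄ : w₂ ≠ w₄)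
    (h₃₄ : w₃ ≠ w₄) :
    HasSum (fun k => (c k : ℂ) / ((w₁ + γ k) * (w₂ + γ k) * ((w₃ + γ k) * (w₄ + γ k)))) 0 := by
  have hs' : (s : ℂ) ≠ 0 := by exact_mod_cast hs
  have hκ' : (κ : ℂ) ≠ 0 := by exact_mod_cast hκ
  have key : ∀ w ∈ scalarZeros c γ s κ, HasSum (fun k => (c k : ℂ) / (w + γ k))
      ((w ^ 2 + s) / (s * κ)) := by
    intro w hw
    convert h.hasSum hw.1 using 1
    have := hw.2
    rw [scalarSymbol] at this
    rw [div_eq_iff (mul_ne_zero hs' hκ')]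
    linear_combination this
  have d₁₂ := sub_ne_zero.2 h₁₂
  have d₁₃ := sub_ne_zero.2 h₁₃
  have d₁₄ := sub_ne_zero.2 h₁₄
  have d₂₃ := sub_ne_zero.2 h₂₃
  have d₂₄ := sub_ne_zero.2 h₂₄
  have d₃₄ := sub_ne_zero.2 h₃₄
  -- The coefficients are minus the weights of the third divided difference: they annihilate the
  -- quadratic (w² + s)/(sκ) and send 1/(w + γₖ) to 1/∏ᵢ(wᵢ + γₖ).
  have hsum := ((((key w₁ h₁).mul_left (-1 / ((w₁ - w₂) * (w₁ - w₃) * (w₁ - w₄)))).add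
    ((key w₂ h₂).mul_left (1 / ((w₁ - w₂) * (w₂ - w₃) * (w₂ - w₄))))).add
    ((key w₃ h₃).mul_left (-1 / ((w₁ - w₃) * (w₂ - w₃) * (w₃ - w₄))))).add
    ((key w₄ h₄).mul_left (1 / ((w₁ - w₄) * (w₂ - w₄) * (w₃ - w₄))))
  have hzero : -1 / ((w₁ - w₂) * (w₁ - w₃) * (w₁ - w₄)) * ((w₁ ^ 2 + s) / (s * κ)) +
      1 / ((w₁ - w₂) * (w₂ - w₃) * (w₂ - w₄)) * ((w₂ ^ 2 + s) / (s * κ)) +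
      -1 / ((w₁ - w₃) * (w₂ - w₃) * (w₃ - w₄)) * ((w₃ ^ 2 + s) / (s * κ)) +
      1 / ((w₁ - w₄) * (w₂ - w₄) * (w₃ - w₄)) * ((w₄ ^ 2 + s) / (s * κ)) = 0 := by
    field_simp
    ring
  rw [hzero] at hsum
  refine Eq.mpr (congrArg (fun f : ℕ → ℂ => HasSum f 0) (funext fun k => ?_)) hsum
  have e₁ := notMem_poles.1 h₁.1 k
  have e₂ := notMem_poles.1 h₂.1 k
  have e₃ := notMem_poles.1 h₃.1 k
  have e₄ := notMem_poles.1 h₄.1 k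
  field_simp
  ring

/-- The divided difference becomes a series of nonnegative terms whose first term is positive, so it
cannot vanish. This does the work of the argument principle in counting zeros. -/
theorem not_four_zeros (hc : 0 < c 0) {s κ : ℝ} (hs : s ≠ 0) (hκ : κ ≠ 0) {w₁ w₂ w₃ w₄ : ℂ}
    (h₁ : w₁ ∈ scalarZeros c γ s κ) (h₂ : w₂ ∈ scalarZeros c γ s κ)
    (h₃ : w₃ ∈ scalarZeros c γ s κ) (h₄ : w₄ ∈ scalarZeros c γ s κ)
    (h₁₂ : w₁ ≠ w₂) (h₁₃ : w₁ ≠ w₃) (h₁₄ : w₁ ≠ w₄) (h₂₃ : w₂ ≠ w₃) (h₂₄ : w₂ ≠ w₄)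
    (h₃₄ : w₃ ≠ w₄) (hp : ∀ k, ∃ p : ℝ, 0 < p ∧ (w₁ + γ k) * (w₂ + γ k) = p)
    (hq : ∀ k, ∃ p : ℝ, 0 < p ∧ (w₃ + γ k) * (w₄ + γ k) = p) : False := by
  have h0 := h.hasSum_div_prod hs hκ h₁ h₂ h₃ h₄ h₁₂ h₁₃ h₁₄ h₂₃ h₂₄ h₃₄
  choose p hp0 hp using hp
  choose q hq0 hq using hq
  have h1 : HasSum (fun k => c k / (p k * q k)) 0 := by
    simp only [hp, hq] at h0
    rw [← Complex.hasSum_ofReal]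
    simpa using h0
  have h2 := (hasSum_zero_iff_of_nonneg fun k =>
    div_nonneg (h.nonneg k) (mul_pos (hp0 k) (hq0 k)).le).1 h1
  exact (div_pos hc (mul_pos (hp0 0) (hq0 0))).ne' (congrFun h2 0)

omit h in
theorem exists_pos_mul_conj {z : ℂ} (hz : z ∉ poles γ) (k : ℕ) :
    ∃ p : ℝ, 0 < p ∧ (z + γ k) * ((starRingEnd ℂ) z + γ k) = p := by
  refine ⟨Complex.normSq (z + γ k), Complex.normSq_pos.2 (notMem_poles.1 hz k), ?_⟩
  rw [← Complex.mul_conj]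
  simp

theorem exists_pos_mul_of_gap {x y : ℝ} {k : ℕ} (hx1 : -γ k < x) (hx2 : ∀ j < k, x < -γ j)
    (hy1 : -γ k < y) (hy2 : ∀ j < k, y < -γ j) (j : ℕ) :
    ∃ p : ℝ, 0 < p ∧ ((x : ℂ) + γ j) * ((y : ℂ) + γ j) = p :=
  ⟨_, h.mul_pos_of_gap hx1 hx2 hy1 hy2 j, by push_cast; ring⟩

/-- Every interval between consecutive poles contains a zero. -/
theorem exists_zero_in_gap (hc : ∀ k, 0 < c k) (h1 : ∑' k, c k / γ k < 1) {s κ : ℝ} (hs : 0 < s)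
    (hκ0 : 0 < κ) (hκ1 : κ ≤ 1) (k : ℕ) :
    ∃ x : ℝ, -γ k < x ∧ (∀ j < k, x < -γ j) ∧ x < 0 ∧ (x : ℂ) ∈ scalarZeros c γ s κ := by
  -- R is the right end of the gap: 0 for the first, the preceding pole otherwise. Just left of it
  -- the symbol is positive, since K̂(0) < 1 in the first case and K̂ → -∞ in the second.
  obtain ⟨R, hR0, hRgap, hkR, v, hv1, hvR, hvpos⟩ : ∃ R ≤ 0, (∀ x < R, ∀ j < k, x < -γ j) ∧
      -γ k < R ∧ ∃ v, -γ k < v ∧ v < R ∧ 0 < v ^ 2 + s * (1 - κ * kernelReal c γ v) := by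
    rcases k with _ | k
    · refine ⟨0, le_rfl, by simp, by simpa using h.pos 0, ?_⟩
      have hK0 : kernelReal c γ 0 < 1 := by simpa [kernelReal] using h1
      have hcont : ContinuousAt (kernelReal c γ) 0 :=
        h.continuousAt_real fun k => Or.inr (by simpa using (h.pos k).ne')
      have h2 : ∀ᶠ v in 𝓝[<] (0 : ℝ), kernelReal c γ v < 1 :=
        (hcont.eventually (gt_mem_nhds hK0)).filter_mono nhdsWithin_le_nhds
      have h3 : ∀ᶠ v in 𝓝[<] (0 : ℝ), -γ 0 < v :=
        (lt_mem_nhds (by simpa using h.pos 0)).filter_mono nhdsWithin_le_nhds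
      obtain ⟨v, hv1, hv2, hv3⟩ := (h2.and (h3.and self_mem_nhdsWithin)).exists
      refine ⟨v, hv2, hv3, ?_⟩
      have : κ * kernelReal c γ v < 1 := by
        rcases le_total (kernelReal c γ v) 0 with hK | hK
        · nlinarith
        · nlinarith
      have : 0 < s * (1 - κ * kernelReal c γ v) := mul_pos hs (by linarith)
      positivity
    · have hlt := h.strictMono (Nat.lt_succ_self k)
      refine ⟨-γ k, by simpa using (h.pos k).le, fun x hx j hj => ?_, by simpa using hlt, ?_⟩
      · have := h.strictMono.monotone (Nat.lt_succ_iff.1 hj)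
        linarith
      have h2 : ∀ᶠ v in 𝓝[<] (-γ k), kernelReal c γ v < 0 :=
        (h.tendsto_kernelReal_left (hc k)).eventually_lt_atBot 0
      have h3 : ∀ᶠ v in 𝓝[<] (-γ k), -γ (k + 1) < v :=
        (lt_mem_nhds (by simpa using hlt)).filter_mono nhdsWithin_le_nhds
      obtain ⟨v, hv1, hv2, hv3⟩ := (h2.and (h3.and self_mem_nhdsWithin)).exists
      refine ⟨v, hv2, hv3, ?_⟩
      have : κ * kernelReal c γ v < 0 := mul_neg_of_pos_of_neg hκ0 hv1
      have : 0 < s * (1 - κ * kernelReal c γ v) := mul_pos hs (by linarith)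
      positivity
  obtain ⟨u, hu1, huR, huneg⟩ : ∃ u, -γ k < u ∧ u < R ∧
      u ^ 2 + s * (1 - κ * kernelReal c γ u) < 0 := by
    -- The threshold gives sκK̂(u) > γₖ² + s > u² + s, as -γₖ < u < 0.
    have h2 := (h.tendsto_kernelReal_right (hc k)).eventually_gt_atTop (((γ k) ^ 2 + s) / (s * κ))
    have h3 : ∀ᶠ v in 𝓝[>] (-γ k), v < R :=
      (gt_mem_nhds hkR).filter_mono nhdsWithin_le_nhds
    obtain ⟨u, hu1, hu2, hu3⟩ := (h2.and (h3.and self_mem_nhdsWithin)).exists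
    have hu3 : -γ k < u := hu3
    refine ⟨u, hu3, hu2, ?_⟩
    rw [div_lt_iff₀ (by positivity)] at hu1
    nlinarith
  have hgap : ∀ x ∈ Set.Ioo (-γ k) R, ∀ j, x + γ j ≠ 0 := fun x hx =>
    h.add_ne_zero_of_gap hx.1 (hRgap x hx.2)
  have hcont : ContinuousOn (fun x => x ^ 2 + s * (1 - κ * kernelReal c γ x))
      (Set.Ioo (-γ k) R) := by
    intro x hx
    have := (h.continuousAt_real fun j => Or.inr (hgap x hx j)).continuousWithinAt
      (s := Set.Ioo (-γ k) R)
    fun_prop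
  obtain ⟨x, hx, hx0⟩ := isPreconnected_Ioo.intermediate_value (a := u) (b := v)
    ⟨hu1, huR⟩ ⟨hv1, hvR⟩ hcont ⟨huneg.le, hvpos.le⟩
  refine ⟨x, hx.1, hRgap x hx.2, hx.2.trans_le hR0, ofReal_notMem_poles.2 (hgap x hx), ?_⟩
  rw [scalarSymbol_ofReal]
  exact_mod_cast hx0

/-- Each interval between consecutive poles contains one zero, and there are at most two more. -/
theorem scalarZeros_structure (hc : ∀ k, 0 < c k) (h1 : ∑' k, c k / γ k < 1) {s κ : ℝ}
    (hs : 0 < s) (hκ0 : 0 < κ) (hκ1 : κ ≤ 1) :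
    ∃ (x : ℕ → ℝ) (zp zm : ℂ), (∀ k, -γ k < x k ∧ (∀ j < k, x k < -γ j) ∧ x k < 0) ∧
      scalarZeros c γ s κ = Set.range (fun k => (x k : ℂ)) ∪ {zp, zm} ∧
      ((∃ z ∈ scalarZeros c γ s κ, z.im ≠ 0) → 0 < zp.im ∧ zm = (starRingEnd ℂ) zp) := by
  choose x hx1 hx2 hx3 hx4 using h.exists_zero_in_gap hc h1 hs hκ0 hκ1
  suffices H : ∃ zp ∈ scalarZeros c γ s κ, ∃ zm ∈ scalarZeros c γ s κ,
      scalarZeros c γ s κ ⊆ Set.range (fun k => (x k : ℂ)) ∪ {zp, zm} ∧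
      ((∃ z ∈ scalarZeros c γ s κ, z.im ≠ 0) → 0 < zp.im ∧ zm = (starRingEnd ℂ) zp) by
    obtain ⟨zp, hzp, zm, hzm, hsub, him⟩ := H
    refine ⟨x, zp, zm, fun k => ⟨hx1 k, hx2 k, hx3 k⟩, hsub.antisymm ?_, him⟩
    rintro z (⟨k, rfl⟩ | rfl | rfl)
    exacts [hx4 k, hzp, hzm]
  -- An additional real zero shares its gap with some x k, and so has a partner with positive
  -- product.
  have real_gap : ∀ w ∈ scalarZeros c γ s κ, w.im = 0 → w ∉ Set.range (fun k => (x k : ℂ)) →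
      ∃ y : ℝ, w = y ∧ ∃ k, -γ k < y ∧ (∀ j < k, y < -γ j) ∧ (x k : ℂ) ≠ y := by
    intro w hw hw0 hwr
    obtain ⟨y, rfl⟩ : ∃ y : ℝ, w = y := ⟨w.re, Complex.ext (by simp) (by simpa using hw0)⟩
    obtain ⟨k, hk1, hk2⟩ := h.gap_cases (ofReal_notMem_poles.1 hw.1)
    exact ⟨y, rfl, k, hk1, hk2, fun he => hwr ⟨k, he⟩⟩
  by_cases hnr : ∃ z ∈ scalarZeros c γ s κ, z.im ≠ 0
  · obtain ⟨z, hz, hz0⟩ : ∃ z ∈ scalarZeros c γ s κ, 0 < z.im := by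
      obtain ⟨z, hz, hz0⟩ := hnr
      rcases lt_or_gt_of_ne hz0 with hlt | hgt
      · exact ⟨_, conj_mem_scalarZeros hz, by simpa using hlt⟩
      · exact ⟨z, hz, hgt⟩
    have hzc : z ≠ (starRingEnd ℂ) z := fun he => by
      have := congrArg Complex.im he
      rw [Complex.conj_im] at this
      linarith
    refine ⟨z, hz, _, conj_mem_scalarZeros hz, fun w hw => ?_, fun _ => ⟨hz0, rfl⟩⟩
    by_contra hcon
    simp only [Set.mem_union, Set.mem_insert_iff, Set.mem_singleton_iff, not_or] at hcon
    obtain ⟨hwr, hwz, hwz'⟩ := hcon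
    by_cases hw0 : w.im = 0
    · obtain ⟨y, rfl, k, hk1, hk2, hne⟩ := real_gap w hw hw0 hwr
      have hxz : ∀ t : ℝ, z ≠ t := fun t he => hz0.ne' (by simp [he])
      have hxz' : ∀ t : ℝ, (starRingEnd ℂ) z ≠ t := fun t he => by
        have := congrArg Complex.im he
        simp only [Complex.conj_im, Complex.ofReal_im, neg_eq_zero] at this
        exact hz0.ne' this
      exact h.not_four_zeros (hc 0) hs.ne' hκ0.ne' hz (conj_mem_scalarZeros hz) (hx4 k) hw
        hzc (hxz _) (hxz _) (hxz' _) (hxz' _) hne (exists_pos_mul_conj hz.1)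
        (h.exists_pos_mul_of_gap (hx1 k) (hx2 k) hk1 hk2)
    · refine h.not_four_zeros (hc 0) hs.ne' hκ0.ne' hz (conj_mem_scalarZeros hz) hw
        (conj_mem_scalarZeros hw) hzc (Ne.symm hwz) ?_ (Ne.symm hwz') ?_ ?_
        (exists_pos_mul_conj hz.1) (exists_pos_mul_conj hw.1)
      · intro he
        exact hwz' (by rw [he, Complex.conj_conj])
      · intro he
        exact hwz ((starRingEnd ℂ).injective he).symm
      · intro he
        have := congrArg Complex.im he
        rw [Complex.conj_im] at this
        exact hw0 (by linarith)
  · have hreal : ∀ z ∈ scalarZeros c γ s κ, z.im = 0 := by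
      simpa using hnr
    by_cases e₁ : scalarZeros c γ s κ ⊆ Set.range (fun k => (x k : ℂ))
    -- With no additional zero both slots repeat x 0, which leaves the union unchanged.
    · exact ⟨_, hx4 0, _, hx4 0, fun w hw => Or.inl (e₁ hw), fun hh => (hnr hh).elim⟩
    obtain ⟨p, hp, hpr⟩ := Set.not_subset.1 e₁
    by_cases e₂ : scalarZeros c γ s κ ⊆ Set.range (fun k => (x k : ℂ)) ∪ {p}
    · exact ⟨p, hp, p, hp, by simpa using e₂, fun hh => (hnr hh).elim⟩
    obtain ⟨q, hq, hqr⟩ := Set.not_subset.1 e₂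
    refine ⟨p, hp, q, hq, fun w hw => ?_, fun hh => (hnr hh).elim⟩
    by_contra hcon
    simp only [Set.mem_union, Set.mem_insert_iff, Set.mem_singleton_iff, not_or] at hcon hqr
    obtain ⟨hwr, hwp, hwq⟩ := hcon
    obtain ⟨hqr, hqp⟩ := hqr
    obtain ⟨p, rfl, i, hi1, hi2, hi⟩ := real_gap p hp (hreal p hp) hpr
    obtain ⟨q, rfl, j, hj1, hj2, hj⟩ := real_gap q hq (hreal q hq) hqr
    obtain ⟨w, rfl, k, hk1, hk2, hk⟩ := real_gap w hw (hreal w hw) hwr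
    have hdisj : ∀ i j : ℕ, ∀ p q : ℝ, i < j → -γ i < p → (∀ l < j, q < -γ l) →
        (p : ℂ) ≠ q := by
      intro i j p q hij hp hq he
      have := hq i hij
      have he : p = q := by exact_mod_cast he
      linarith
    have two_gaps : ∀ i j : ℕ, i < j → ∀ p q : ℝ, (p : ℂ) ∈ scalarZeros c γ s κ →
        (q : ℂ) ∈ scalarZeros c γ s κ → -γ i < p → (∀ l < i, p < -γ l) → (x i : ℂ) ≠ p →
        -γ j < q → (∀ l < j, q < -γ l) → (x j : ℂ) ≠ q → False := by
      intro i j hij p q hp hq hp1 hp2 hpx hq1 hq2 hqx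
      exact h.not_four_zeros (hc 0) hs.ne' hκ0.ne' (hx4 i) hp (hx4 j) hq hpx
        (hdisj i j _ _ hij (hx1 i) (hx2 j)) (hdisj i j _ _ hij (hx1 i) hq2)
        (hdisj i j _ _ hij hp1 (hx2 j)) (hdisj i j _ _ hij hp1 hq2) hqx
        (h.exists_pos_mul_of_gap (hx1 i) (hx2 i) hp1 hp2)
        (h.exists_pos_mul_of_gap (hx1 j) (hx2 j) hq1 hq2)
    -- Among three additional real zeros, either two lie in different gaps and pair with the x of
    -- their gaps, or all three share a gap and with its x make four zeros there.
    rcases lt_trichotomy i j with hij | rfl | hij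
    · exact two_gaps i j hij p q hp hq hi1 hi2 hi hj1 hj2 hj
    · rcases lt_trichotomy i k with hik | rfl | hik
      · exact two_gaps i k hik p w hp hw hi1 hi2 hi hk1 hk2 hk
      · exact h.not_four_zeros (hc 0) hs.ne' hκ0.ne' (hx4 i) hp hq hw hi hj hk (Ne.symm hqp)
          (Ne.symm hwp) (Ne.symm hwq) (h.exists_pos_mul_of_gap (hx1 i) (hx2 i) hi1 hi2)
          (h.exists_pos_mul_of_gap hj1 hj2 hk1 hk2)
      · exact two_gaps k i hik w p hw hp hk1 hk2 hk hi1 hi2 hi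
    · exact two_gaps j i hij q p hq hp hj1 hj2 hj hi1 hi2 hi

/-! ### Convergence of the real zeros to the poles -/

/-- In the gap the terms with j < k are nonpositive and those with j > k are bounded by their values
at -γₖ, so one M serves the whole gap. -/
theorem kernelReal_le_of_gap (k : ℕ) :
    ∃ M : ℝ, ∀ x, -γ k < x → (∀ j < k, x < -γ j) →
      kernelReal c γ x ≤ c k / (x + γ k) + M := by
  have hv := ((h.update k).summable_of_regular (h.regular_update k)).norm
  refine ⟨∑' j, ‖(Function.update c k 0 j : ℂ) / (-(γ k : ℂ) + γ j)‖, fun x hx1 hx2 => ?_⟩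
  have hx := h.add_ne_zero_of_gap hx1 hx2
  rw [h.kernelReal_eq_add hx k]
  refine add_le_add_right (Summable.tsum_le_tsum (fun j => ?_)
    ((h.update k).hasSum_real hx).summable hv) _
  rcases lt_trichotomy j k with hj | rfl | hj
  · have := hx2 j hj
    rw [Function.update_of_ne hj.ne]
    exact (div_nonpos_of_nonneg_of_nonpos (h.nonneg j) (by linarith)).trans (norm_nonneg _)
  · simp
  · have h2 := h.strictMono hj
    rw [Function.update_of_ne hj.ne', ← Complex.ofReal_neg, ← Complex.ofReal_add,
      ← Complex.ofReal_div, Complex.norm_real]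
    refine le_trans ?_ (le_abs_self _)
    exact div_le_div_of_nonneg_left (h.nonneg j) (by linarith) (by linarith)

/-- At a real zero κK̂ ≥ 1, so K̂ ≥ 1/κ → ∞; the previous bound then gives 0 < x + γₖ ≤ cₖ/(1/κ -
M). -/
theorem tendsto_zero_of_gap {s κ x : ℕ → ℝ} {k : ℕ} (hs : ∀ n, 0 < s n) (hκ0 : ∀ n, 0 < κ n)
    (hκ : Tendsto κ atTop (𝓝 0)) (hx1 : ∀ n, -γ k < x n) (hx2 : ∀ n, ∀ j < k, x n < -γ j)
    (hx : ∀ n, (x n : ℂ) ∈ scalarZeros c γ (s n) (κ n)) :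
    Tendsto x atTop (𝓝 (-γ k)) := by
  obtain ⟨M, hM⟩ := h.kernelReal_le_of_gap k
  have hinv : Tendsto (fun n => (κ n)⁻¹ - M) atTop atTop :=
    tendsto_atTop_add_const_right _ _ (tendsto_inv_nhdsGT_zero.comp
      (tendsto_nhdsWithin_iff.2 ⟨hκ, Eventually.of_forall hκ0⟩))
  have hlim : Tendsto (fun n => -γ k + c k * ((κ n)⁻¹ - M)⁻¹) atTop (𝓝 (-γ k)) := by
    simpa using ((tendsto_inv_atTop_zero.comp hinv).const_mul (c k)).const_add (-γ k)
  refine tendsto_of_tendsto_of_tendsto_of_le_of_le' tendsto_const_nhds hlim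
    (Eventually.of_forall fun n => (hx1 n).le) ?_
  filter_upwards [hinv.eventually_gt_atTop 0] with n hn
  have h0 := (hx n).2
  rw [scalarSymbol_ofReal, Complex.ofReal_eq_zero] at h0
  have hK : (κ n)⁻¹ ≤ kernelReal c γ (x n) := by
    rw [inv_le_iff_one_le_mul₀ (hκ0 n)]
    by_contra hlt
    have : 0 < s n * (1 - κ n * kernelReal c γ (x n)) := mul_pos (hs n) (by linarith)
    nlinarith
  have h2 := hM (x n) (hx1 n) (hx2 n)
  have h3 : (κ n)⁻¹ - M ≤ c k / (x n + γ k) := by linarith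
  have h4 : 0 < x n + γ k := by linarith [hx1 n]
  rw [le_div_iff₀ h4] at h3
  have h5 : x n + γ k ≤ c k * ((κ n)⁻¹ - M)⁻¹ := by
    rw [← div_eq_mul_inv, le_div_iff₀ hn]
    linarith
  linarith

/-! ### Existence of the non-real pair -/

/-- `K̂` is uniformly small on the discs `|z - i t| ≤ t / 2` as `t → ∞`. -/
theorem eventually_norm_kernelHat_le {ε : ℝ} (hε : 0 < ε) :
    ∀ᶠ t : ℝ in atTop, ∀ μ ∈ Metric.closedBall Complex.I (1 / 2),
      ‖kernelHat c γ (t * μ)‖ ≤ ε := by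
  -- Only ∑ cₖ/γₖ is known to converge, so the decay 2cₖ/t of single terms is summed by dominated
  -- convergence.
  have hlim : Tendsto (fun t : ℝ => ∑' k, min (4 * (c k / γ k)) (2 * c k / t)) atTop
      (𝓝 (∑' _ : ℕ, (0 : ℝ))) := by
    refine tendsto_tsum_of_dominated_convergence (bound := fun k => 4 * (c k / γ k))
      (h.summable.mul_left 4) (fun k => ?_) ?_
    · have h0 : 0 ≤ 4 * (c k / γ k) := by have := h.nonneg k; have := h.pos k; positivity
      have h1 : Tendsto (fun t : ℝ => 2 * c k / t) atTop (𝓝 0) :=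
        tendsto_const_nhds.div_atTop tendsto_id
      simpa [h0] using (tendsto_const_nhds (x := 4 * (c k / γ k))).min h1
    · filter_upwards [eventually_gt_atTop 0] with t ht k
      have := h.nonneg k
      have := h.pos k
      rw [Real.norm_of_nonneg (by positivity)]
      exact min_le_left _ _
  rw [tsum_zero] at hlim
  filter_upwards [hlim.eventually (gt_mem_nhds hε), eventually_gt_atTop 0] with t ht ht0 μ hμ
  refine le_trans ?_ ht.le
  rw [Metric.mem_closedBall, dist_eq_norm] at hμ
  have him : 1 / 2 ≤ μ.im := by
    have := (Complex.abs_im_le_norm (μ - Complex.I)).trans hμ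
    rw [Complex.sub_im, Complex.I_im, abs_le] at this
    linarith
  have hnorm : ‖μ‖ ≤ 3 / 2 := by
    have := norm_add_le (μ - Complex.I) Complex.I
    rw [sub_add_cancel, Complex.norm_I] at this
    linarith
  refine tsum_of_norm_bounded (Summable.hasSum ?_) fun k => ?_
  · refine Summable.of_nonneg_of_le (fun k => ?_) (fun k => min_le_left _ _)
      (h.summable.mul_left 4)
    have := h.nonneg k
    have := h.pos k
    positivity
  have hck := h.nonneg k
  have hγk := h.pos k
  have h1 : t / 2 ≤ ‖(t : ℂ) * μ + γ k‖ := by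
    have h2 := (le_abs_self _).trans (Complex.abs_im_le_norm ((t : ℂ) * μ + γ k))
    simp only [Complex.add_im, Complex.mul_im, Complex.ofReal_re, Complex.ofReal_im, zero_mul,
      add_zero] at h2
    nlinarith
  -- γₖ ≤ |tμ + γₖ| + 3t/2, and t/2 ≤ |tμ + γₖ| by the imaginary part.
  have h3 : γ k ≤ 4 * ‖(t : ℂ) * μ + γ k‖ := by
    have h4 := norm_sub_le ((t : ℂ) * μ + γ k) (t * μ)
    rw [add_sub_cancel_left, Complex.norm_of_nonneg hγk.le, norm_mul,
      Complex.norm_of_nonneg ht0.le] at h4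
    nlinarith
  rw [norm_div, Complex.norm_of_nonneg hck]
  refine le_min ?_ ?_
  · calc c k / ‖(t : ℂ) * μ + γ k‖ ≤ c k / (γ k / 4) :=
        div_le_div_of_nonneg_left hck (by positivity) (by linarith)
      _ = 4 * (c k / γ k) := by field_simp
  · calc c k / ‖(t : ℂ) * μ + γ k‖ ≤ c k / (t / 2) :=
        div_le_div_of_nonneg_left hck (by positivity) h1
      _ = 2 * c k / t := by field_simp

/-- For large `t` the function with `s = t²` has a zero in the disc `|z - i t| ≤ t / 2`. -/
theorem eventually_exists_nonreal_zero :
    ∀ᶠ t : ℝ in atTop, ∀ κ ∈ Set.Icc (0 : ℝ) 1,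
      ∃ z ∈ scalarZeros c γ (t ^ 2) κ, z.im ≠ 0 := by
  filter_upwards [h.eventually_norm_kernelHat_le (ε := 1 / 16) (by norm_num),
    eventually_gt_atTop 0] with t ht ht0 κ hκ
  -- This is the symbol at tμ divided by t², within 1/16 of μ² + 1 on the disc.
  set f : ℂ → ℂ := fun μ => μ ^ 2 + (1 - κ * kernelHat c γ (t * μ)) with hf
  have hsmall : ∀ μ ∈ Metric.closedBall Complex.I (1 / 2),
      ‖(κ : ℂ) * kernelHat c γ (t * μ)‖ ≤ 1 / 16 := by
    intro μ hμ
    rw [norm_mul, Complex.norm_of_nonneg hκ.1]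
    exact (mul_le_of_le_one_left (norm_nonneg _) hκ.2).trans (ht μ hμ)
  have him : ∀ μ ∈ Metric.closedBall Complex.I (1 / 2), 0 < μ.im := by
    intro μ hμ
    rw [Metric.mem_closedBall, dist_eq_norm] at hμ
    have := (Complex.abs_im_le_norm (μ - Complex.I)).trans hμ
    rw [Complex.sub_im, Complex.I_im, abs_le] at this
    linarith
  have hnp : ∀ μ : ℂ, 0 < μ.im → (t : ℂ) * μ ∉ poles γ := fun μ hμ =>
    notMem_poles_of_im_ne_zero (by simpa using (⟨ht0.ne', hμ.ne'⟩ : t ≠ 0 ∧ μ.im ≠ 0))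
  have hdiff : DifferentiableOn ℂ f {μ | 0 < μ.im} := by
    intro μ hμ
    have h1 : DifferentiableAt ℂ (fun μ : ℂ => kernelHat c γ (t * μ)) μ :=
      (h.differentiableAt (hnp μ hμ)).comp μ (by fun_prop)
    exact DifferentiableAt.differentiableWithinAt (by fun_prop)
  have hopen : IsOpen {μ : ℂ | 0 < μ.im} := isOpen_lt continuous_const Complex.continuous_im
  -- On the circle |μ² + 1| = |μ + i|/2 ≥ 3/4, and the perturbations cost at most 1/8.
  have hsphere : ∀ μ ∈ Metric.sphere Complex.I (1 / 2), 1 / 2 ≤ ‖f μ - f Complex.I‖ := by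
    intro μ hμ
    have h1 := hsmall μ (Metric.sphere_subset_closedBall hμ)
    have h2 := hsmall Complex.I (Metric.mem_closedBall_self (by norm_num))
    rw [Metric.mem_sphere, dist_eq_norm] at hμ
    have h3 : 3 / 2 ≤ ‖μ + Complex.I‖ := by
      have := norm_sub_le_norm_add (2 * Complex.I) (μ - Complex.I)
      rw [hμ, norm_mul, Complex.norm_I, Complex.norm_ofNat] at this
      have e : 2 * Complex.I + (μ - Complex.I) = μ + Complex.I := by ring
      rw [e] at this
      linarith
    have h4 : f μ - f Complex.I = (μ - Complex.I) * (μ + Complex.I) -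
        (κ * kernelHat c γ (t * μ) - κ * kernelHat c γ (t * Complex.I)) := by
      simp only [hf]
      ring
    have h5 := norm_sub_norm_le ((μ - Complex.I) * (μ + Complex.I))
      (κ * kernelHat c γ (t * μ) - κ * kernelHat c γ (t * Complex.I))
    have h6 := norm_sub_le (κ * kernelHat c γ (t * μ)) (κ * kernelHat c γ (t * Complex.I))
    rw [norm_mul (μ - Complex.I), hμ] at h5
    rw [h4]
    linarith
  have hfreq : ∃ᶠ μ in 𝓝 Complex.I, f μ ≠ f Complex.I := by
    by_contra hcon
    simp only [not_frequently, not_not] at hcon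
    have hpre : IsPreconnected (Metric.closedBall Complex.I (1 / 2)) :=
      (convex_closedBall _ _).isPreconnected
    have heq := AnalyticOnNhd.eqOn_of_preconnected_of_eventuallyEq
      ((hdiff.analyticOnNhd hopen).mono him) analyticOnNhd_const hpre
      (Metric.mem_closedBall_self (by norm_num)) hcon
    have hmem : Complex.I + (1 / 2 : ℝ) ∈ Metric.sphere Complex.I (1 / 2) := by
      rw [Metric.mem_sphere, dist_eq_norm, add_sub_cancel_left, Complex.norm_real]
      norm_num
    have h1 := hsphere _ hmem
    rw [heq (Metric.sphere_subset_closedBall hmem), sub_self, norm_zero] at h1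
    norm_num at h1
  have hdc : DiffContOnCl ℂ f (Metric.ball Complex.I (1 / 2)) := by
    refine DifferentiableOn.diffContOnCl (hdiff.mono ?_)
    rw [closure_ball _ (by norm_num)]
    exact him
  obtain ⟨μ, hμ, hμ0⟩ : (0 : ℂ) ∈ f '' Metric.closedBall Complex.I (1 / 2) := by
    -- The image contains the ball of radius 1/4 about f(i), and |f(i)| ≤ 1/16.
    refine hdc.ball_subset_image_closedBall (by norm_num) hsphere hfreq ?_
    have h2 := hsmall Complex.I (Metric.mem_closedBall_self (by norm_num))
    have : f Complex.I = -(κ * kernelHat c γ (t * Complex.I)) := by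
      simp only [hf, Complex.I_sq]
      ring
    rw [Metric.mem_ball, dist_eq_norm, zero_sub, norm_neg, this, norm_neg]
    linarith
  refine ⟨t * μ, ⟨hnp μ (him μ hμ), ?_⟩, by simpa using ⟨ht0.ne', (him μ hμ).ne'⟩⟩
  have : scalarSymbol c γ (t ^ 2) κ (t * μ) = t ^ 2 * f μ := by
    simp only [scalarSymbol, hf]
    push_cast
    ring
  rw [this, hμ0, mul_zero]

end IsAdmissible

/-! ### Diagonal operators and the resolvent set -/

variable {H : Type*} [NormedAddCommGroup H] [InnerProductSpace ℂ H]

theorem repr_ext {e : HilbertBasis ℕ ℂ H} {x y : H}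
    (h : ∀ n, e.repr x n = e.repr y n) : x = y :=
  e.repr.injective (lp.ext (funext h))

theorem repr_basis_of_ne {e : HilbertBasis ℕ ℂ H} {m n : ℕ} (h : n ≠ m) :
    e.repr (e m) n = 0 := by
  rw [e.repr_self, lp.single_apply_ne _ _ _ h]

theorem repr_basis_self {e : HilbertBasis ℕ ℂ H} (n : ℕ) :
    e.repr (e n) n = 1 := by
  rw [e.repr_self, lp.single_apply_self]

theorem memℓp_mul_of_bounded {d : ℕ → ℂ} {C : ℝ} (hd : ∀ n, ‖d n‖ ≤ C) {f : ℕ → ℂ}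
    (hf : Memℓp f 2) : Memℓp (fun n => d n * f n) 2 := by
  refine Memℓp.mono' (g := fun n => (C : ℂ) * f n) (hf.const_mul (C : ℂ)) fun n => ?_
  have hC : 0 ≤ C := (norm_nonneg _).trans (hd n)
  rw [norm_mul, norm_mul, Complex.norm_of_nonneg hC]
  exact mul_le_mul_of_nonneg_right (hd n) (norm_nonneg _)

/-- A bounded operator that is diagonal in the basis `e`. -/
theorem exists_diagonal (e : HilbertBasis ℕ ℂ H) {d : ℕ → ℂ} {C : ℝ} (hd : ∀ n, ‖d n‖ ≤ C) :
    ∃ T : H →L[ℂ] H, ∀ x n, e.repr (T x) n = d n * e.repr x n := by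
  have hC : 0 ≤ C := (norm_nonneg _).trans (hd 0)
  let F : H →ₗ[ℂ] H :=
    { toFun := fun x => e.repr.symm ⟨_, memℓp_mul_of_bounded hd (lp.memℓp (e.repr x))⟩
      map_add' := fun x y => repr_ext (e := e) fun n => by
        simp only [map_add, LinearIsometryEquiv.apply_symm_apply, lp.coeFn_add, Pi.add_apply, mul_add]
      map_smul' := fun z x => repr_ext (e := e) fun n => by
        simp [mul_left_comm] }
  have hF : ∀ x n, e.repr (F x) n = d n * e.repr x n := fun x n => by simp [F]
  refine ⟨F.mkContinuous C fun x => ?_, fun x n => by simp [hF]⟩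
  have h1 : ‖e.repr (F x)‖ ≤ ‖(C : ℂ) • e.repr x‖ := by
    refine lp.norm_mono (by norm_num) fun n => ?_
    rw [hF, lp.coeFn_smul, Pi.smul_apply, smul_eq_mul, norm_mul, norm_mul,
      Complex.norm_of_nonneg hC]
    exact mul_le_mul_of_nonneg_right (hd n) (norm_nonneg _)
  rwa [norm_smul, Complex.norm_of_nonneg hC, e.repr.norm_map, e.repr.norm_map] at h1

section Inverse

variable {A : H →ₗ.[ℂ] H} {e : HilbertBasis ℕ ℂ H} {a : ℕ → ℝ} {T : H →L[ℂ] H}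
  (he : ∀ n, ∃ h : e n ∈ A.domain, A ⟨e n, h⟩ = (a n : ℂ) • e n) (ha : ∀ n, 1 ≤ a n)
  (hT : IsBoundedInverse A T)
include he ha hT

/-- Both sides are continuous functionals of z agreeing on the basis. The unbounded A is handled
through T from here on. -/
theorem repr_inverse (z : H) (n : ℕ) : e.repr (T z) n = (a n : ℂ)⁻¹ * e.repr z n := by
  have ha0 : ∀ m, (a m : ℂ) ≠ 0 := fun m => by
    exact_mod_cast (zero_lt_one.trans_le (ha m)).ne'
  have hTe : ∀ m, T (e m) = (a m : ℂ)⁻¹ • e m := fun m => by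
    obtain ⟨hm, h1⟩ := he m
    have h2 := hT.1 ⟨e m, hm⟩
    rw [h1, map_smul] at h2
    rw [eq_inv_smul_iff₀ (ha0 m), h2]
  have hext : (innerSL ℂ (e n)).comp T = (a n : ℂ)⁻¹ • innerSL ℂ (e n) := by
    refine ContinuousLinearMap.ext_on (s := Set.range e) ?_ ?_
    · exact Submodule.dense_iff_topologicalClosure_eq_top.2 e.dense_span
    · rintro _ ⟨m, rfl⟩
      rcases eq_or_ne n m with rfl | hnm
      · simp [hTe]
      · have h0 : inner ℂ (e n) (e m) = 0 := e.orthonormal.2 hnm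
        simp [hTe, h0]
  have := congrArg (fun F : H →L[ℂ] ℂ => F z) hext
  simpa [e.repr_apply_apply] using this

theorem repr_apply (x : A.domain) (n : ℕ) : e.repr (A x) n = a n * e.repr (x : H) n := by
  have ha0 : (a n : ℂ) ≠ 0 := by exact_mod_cast (zero_lt_one.trans_le (ha n)).ne'
  have h1 := repr_inverse he ha hT (A x) n
  rw [hT.1 x] at h1
  rw [h1, mul_inv_cancel_left₀ ha0]

theorem repr_sqOp (x : (sqOp A).domain) (n : ℕ) :
    e.repr (sqOp A x) n = (a n : ℂ) ^ 2 * e.repr (x : H) n := by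
  obtain ⟨x, hx0, hx⟩ := x
  obtain ⟨y, hy, rfl⟩ := hx0
  have h1 : sqOp A ⟨_, ⟨⟨y, hy, rfl⟩, hx⟩⟩ = A ⟨A y, hy⟩ := rfl
  rw [h1, repr_apply he ha hT, repr_apply he ha hT]
  simp only [Submodule.subtype_apply]
  ring

/-- If z has the coordinates aₙ²xₙ, then x = T(Tz), and T maps into the domain of A. -/
theorem mem_sqOp_domain {x : H} (hx : Memℓp (fun n => (a n : ℂ) ^ 2 * e.repr x n) 2) :
    x ∈ (sqOp A).domain := by
  let z : H := e.repr.symm ⟨_, hx⟩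
  have hz : ∀ n, e.repr z n = (a n : ℂ) ^ 2 * e.repr x n := fun n => by simp [z]
  have hTT : T (T z) = x := repr_ext (e := e) fun n => by
    have ha0 : (a n : ℂ) ≠ 0 := by exact_mod_cast (zero_lt_one.trans_le (ha n)).ne'
    rw [repr_inverse he ha hT, repr_inverse he ha hT, hz]
    field_simp
  obtain ⟨h1, -⟩ := hT.2 z
  obtain ⟨h2, h3⟩ := hT.2 (T z)
  have hxd : x ∈ A.domain := hTT ▸ h2
  have hAx : A ⟨x, hxd⟩ = T z := by
    rw [← h3]
    congr 1
    exact Subtype.ext hTT.symm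
  have hsq : x ∈ sqDomain A := ⟨⟨x, hxd⟩, by
    change A ⟨x, hxd⟩ ∈ A.domain
    rwa [hAx], rfl⟩
  exact ⟨hsq, hxd⟩

/-- The eigenvalues of an operator with compact inverse tend to infinity. -/
theorem tendsto_eigenvalues (hTc : IsCompactOperator T) (hmono : Monotone a) :
    Tendsto a atTop atTop := by
  rcases tendsto_atTop_of_monotone hmono with h | ⟨M, hM⟩
  · exact h
  exfalso
  have haM : ∀ n, a n ≤ M := hmono.ge_of_tendsto hM
  have hM0 : 0 < M := zero_lt_one.trans_le ((ha 0).trans (haM 0))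
  obtain ⟨K, hK, hKT⟩ := hTc.image_closedBall_subset_compact (𝕜₁ := ℂ) 1
  obtain ⟨y, -, φ, hφ, hy⟩ := hK.tendsto_subseq (x := fun n => T (e n)) fun n =>
    hKT ⟨e n, by simp [e.orthonormal.1 n], rfl⟩
  obtain ⟨N, hN⟩ := Metric.cauchySeq_iff.1 hy.cauchySeq M⁻¹ (inv_pos.2 hM0)
  have h1 := hN N le_rfl (N + 1) (Nat.le_succ N)
  have hne : φ N ≠ φ (N + 1) := (hφ (Nat.lt_succ_self N)).ne
  -- Pairing with one basis vector shows that the images of two of them are at least 1/M apart.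
  have h2 := norm_inner_le_norm (𝕜 := ℂ) (e (φ N)) (T (e (φ N)) - T (e (φ (N + 1))))
  rw [← e.repr_apply_apply, map_sub, lp.coeFn_sub, Pi.sub_apply, repr_inverse he ha hT,
    repr_inverse he ha hT, repr_basis_self, repr_basis_of_ne hne,
    e.orthonormal.1, mul_one, mul_zero, sub_zero, one_mul, norm_inv,
    Complex.norm_of_nonneg (zero_le_one.trans (ha _))] at h2
  have h3 : M⁻¹ ≤ (a (φ N))⁻¹ := inv_anti₀ (zero_lt_one.trans_le (ha _)) (haM _)
  rw [dist_eq_norm] at h1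
  simp only [Function.comp_apply] at h1
  linarith

omit he hT in
theorem ell_eq (θ : ℝ) (c γ : ℕ → ℝ) (lam : ℂ) (n : ℕ) :
    ell a c γ θ n lam = lam ^ 2 + ((a n : ℂ) ^ 2 -
      kernelHat c γ lam * ((a n ^ (2 * θ) : ℝ) : ℂ)) := by
  have ha0 : 0 < a n := zero_lt_one.trans_le (ha n)
  have h1 : a n ^ (2 * θ) * a n ^ (2 * (1 - θ)) = a n ^ 2 := by
    rw [← Real.rpow_add ha0, ← Real.rpow_natCast]
    congr 1
    push_cast
    ring
  have h2 : ((a n ^ (2 * (1 - θ)) : ℝ) : ℂ) ≠ 0 := by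
    exact_mod_cast (Real.rpow_pos_of_pos ha0 _).ne'
  have h3 : ((a n ^ (2 * θ) : ℝ) : ℂ) = (a n : ℂ) ^ 2 / ((a n ^ (2 * (1 - θ)) : ℝ) : ℂ) := by
    rw [eq_div_iff h2]
    exact_mod_cast h1
  rw [ell, h3]
  ring

theorem repr_symbol (θ : ℝ) (c γ : ℕ → ℝ) (lam : ℂ) (x : (symbol A e a c γ θ lam).domain)
    (n : ℕ) : e.repr (symbol A e a c γ θ lam x) n = ell a c γ θ n lam * e.repr (x : H) n := by
  obtain ⟨x, hx⟩ := x
  have hx' : x ∈ (sqOp A).domain ⊓ (powOp e a (2 * θ)).domain := hx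
  have h1 : symbol A e a c γ θ lam ⟨x, hx⟩ = lam ^ 2 • x + (sqOp A ⟨x, hx'.1⟩ -
      kernelHat c γ lam • powOp e a (2 * θ) ⟨x, hx'.2⟩) := rfl
  have h2 : e.repr (powOp e a (2 * θ) ⟨x, hx'.2⟩) n =
      ((a n ^ (2 * θ) : ℝ) : ℂ) * e.repr x n := by
    change e.repr (e.repr.symm _) n = _
    rw [LinearIsometryEquiv.apply_symm_apply]
    rfl
  rw [h1, ell_eq ha, map_add, map_sub, map_smul, map_smul]
  simp only [lp.coeFn_add, lp.coeFn_sub, lp.coeFn_smul, Pi.add_apply, Pi.sub_apply,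
    Pi.smul_apply, smul_eq_mul, h2, repr_sqOp he ha hT]
  ring

theorem mem_symbol_domain {θ : ℝ} (hθ : θ ≤ 1) (c γ : ℕ → ℝ) (lam : ℂ) {x : H}
    (hx : Memℓp (fun n => (a n : ℂ) ^ 2 * e.repr x n) 2) :
    x ∈ (symbol A e a c γ θ lam).domain := by
  change x ∈ (sqOp A).domain ⊓ (powOp e a (2 * θ)).domain
  refine ⟨mem_sqOp_domain he ha hT hx, ?_⟩
  change Memℓp (fun n => ((a n ^ (2 * θ) : ℝ) : ℂ) * e.repr x n) 2
  refine hx.mono' fun n => ?_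
  have ha0 : 0 < a n := zero_lt_one.trans_le (ha n)
  rw [norm_mul, norm_mul, norm_pow, Complex.norm_of_nonneg (Real.rpow_nonneg ha0.le _),
    Complex.norm_of_nonneg ha0.le, ← Real.rpow_natCast (a n) 2]
  exact mul_le_mul_of_nonneg_right (Real.rpow_le_rpow_of_exponent_le (ha n)
    (by push_cast; linarith)) (norm_nonneg _)

/-- A bound below by δ alone would make the diagonal inverse bounded; the factor aₙ² also puts its
range in the domain of A². -/
theorem mem_symbolResolventSet {θ : ℝ} (hθ : θ ≤ 1) {c γ : ℕ → ℝ} {lam : ℂ}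
    (hlam : lam ∉ poles γ) {δ : ℝ} (hδ : 0 < δ)
    (hell : ∀ n, δ * a n ^ 2 ≤ ‖ell a c γ θ n lam‖) :
    lam ∈ symbolResolventSet A e a c γ θ := by
  have hbd : ∀ n, 0 < ‖ell a c γ θ n lam‖ ∧ δ ≤ ‖ell a c γ θ n lam‖ := fun n => by
    have h1 := ha n
    have h2 := hell n
    have h3 : 1 ≤ a n ^ 2 := one_le_pow₀ h1
    have h4 : δ ≤ δ * a n ^ 2 := le_mul_of_one_le_right hδ.le h3
    exact ⟨by linarith, by linarith⟩
  obtain ⟨S, hS⟩ := exists_diagonal e (d := fun n => (ell a c γ θ n lam)⁻¹) (C := δ⁻¹) fun n => by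
    rw [norm_inv]
    exact inv_anti₀ hδ (hbd n).2
  refine ⟨hlam, S, fun x => repr_ext (e := e) fun n => ?_, fun y => ?_⟩
  · rw [hS, repr_symbol he ha hT, inv_mul_cancel_left₀ (norm_pos_iff.1 (hbd n).1)]
  · have hdom : S y ∈ (symbol A e a c γ θ lam).domain := by
      refine mem_symbol_domain he ha hT hθ c γ lam ?_
      simp only [hS, ← mul_assoc]
      refine memℓp_mul_of_bounded (C := δ⁻¹) (fun n => ?_) (lp.memℓp _)
      rw [norm_mul, norm_inv, norm_pow, Complex.norm_of_nonneg (zero_le_one.trans (ha n)),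
        ← div_eq_mul_inv, div_le_iff₀ (hbd n).1, ← div_eq_inv_mul, le_div_iff₀ hδ, mul_comm]
      exact hell n
    exact ⟨hdom, repr_ext (e := e) fun n => by
      rw [repr_symbol he ha hT]
      simp only [hS]
      rw [mul_inv_cancel_left₀ (norm_pos_iff.1 (hbd n).1)]⟩

theorem notMem_symbolResolventSet_of_ell {θ : ℝ} (hθ : θ ≤ 1) {c γ : ℕ → ℝ} {lam : ℂ} {n : ℕ}
    (hn : ell a c γ θ n lam = 0) : lam ∉ symbolResolventSet A e a c γ θ := by
  rintro ⟨-, S, hS, -⟩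
  have hdom : e n ∈ (symbol A e a c γ θ lam).domain := by
    refine mem_symbol_domain he ha hT hθ c γ lam ?_
    refine ((lp.memℓp (e.repr (e n))).const_mul ((a n : ℂ) ^ 2)).mono' fun m => ?_
    rcases eq_or_ne m n with rfl | hm
    · rfl
    · simp [repr_basis_of_ne hm]
  have h0 : symbol A e a c γ θ lam ⟨e n, hdom⟩ = 0 := repr_ext (e := e) fun m => by
    rw [repr_symbol he ha hT]
    rcases eq_or_ne m n with rfl | hm
    · simp [hn]
    · simp [repr_basis_of_ne hm]
  have h1 : S (symbol A e a c γ θ lam ⟨e n, hdom⟩) = e n := hS ⟨e n, hdom⟩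
  rw [h0, map_zero] at h1
  have h2 := e.orthonormal.1 n
  rw [← h1, norm_zero] at h2
  exact zero_ne_one h2

/-- Here L(λ) is ω times the identity on its domain, so surjectivity would make A everywhere
defined. Then T is bijective, its inverse is bounded by the open mapping theorem, and aₙ → ∞ is
contradicted. The case ω = 0 is included. -/
theorem notMem_symbolResolventSet_of_const [CompleteSpace H] {θ : ℝ} {c γ : ℕ → ℝ} {lam ω : ℂ}
    (hat : Tendsto a atTop atTop) (hell : ∀ n, ell a c γ θ n lam = ω) :
    lam ∉ symbolResolventSet A e a c γ θ := by
  rintro ⟨-, S, -, hS⟩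
  have hdom : ∀ y, y ∈ A.domain := fun y => by
    obtain ⟨h1, h2⟩ := hS y
    have h3 : y = ω • S y := repr_ext (e := e) fun n => by
      rw [map_smul, lp.coeFn_smul, Pi.smul_apply, smul_eq_mul]
      conv_lhs => rw [← h2]
      rw [repr_symbol he ha hT, hell]
    rw [h3]
    have h4 : S y ∈ (sqOp A).domain ⊓ (powOp e a (2 * θ)).domain := h1
    exact A.domain.smul_mem _ h4.1.2
  have hker : (T : H →ₗ[ℂ] H).ker = ⊥ := by
    rw [LinearMap.ker_eq_bot']
    intro z hz
    obtain ⟨h1, h2⟩ := hT.2 z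
    have h3 : (⟨T z, h1⟩ : A.domain) = 0 := Subtype.ext hz
    rw [← h2, h3, LinearPMap.map_zero]
  have hrange : (T : H →ₗ[ℂ] H).range = ⊤ :=
    LinearMap.range_eq_top.2 fun y => ⟨A ⟨y, hdom y⟩, hT.1 ⟨y, hdom y⟩⟩
  let E := ContinuousLinearEquiv.ofBijective T hker hrange
  obtain ⟨n, hn⟩ := (hat.eventually_gt_atTop ‖(E.symm : H →L[ℂ] H)‖).exists
  have h1 := (E.symm : H →L[ℂ] H).le_opNorm (T (e n))
  have h2 : (E.symm : H →L[ℂ] H) (T (e n)) = e n :=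
    ContinuousLinearEquiv.ofBijective_symm_apply_apply T hker hrange (e n)
  have ha0 : 0 < a n := zero_lt_one.trans_le (ha n)
  have h3 : T (e n) = (a n : ℂ)⁻¹ • e n := repr_ext (e := e) fun m => by
    rw [repr_inverse he ha hT, map_smul, lp.coeFn_smul, Pi.smul_apply, smul_eq_mul]
    rcases eq_or_ne m n with rfl | hm
    · rfl
    · simp [repr_basis_of_ne hm]
  rw [h2, h3, norm_smul, norm_inv, Complex.norm_of_nonneg ha0.le, e.orthonormal.1, mul_one,
    ← div_eq_mul_inv, le_div_iff₀ ha0, one_mul] at h1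
  linarith

end Inverse

/-! ### The closure of the union of the zero sets -/

/-- A function `z² + s n (1 - κ n K̂(z))` with `s n → ∞` grows like `s n`, locally uniformly near
the points where the limit of `1 - κ n K̂` does not vanish. -/
theorem IsAdmissible.eventually_scalarSymbol_ge {c γ : ℕ → ℝ} (h : IsAdmissible c γ)
    {s κ : ℕ → ℝ} {l : ℝ} (hs : Tendsto s atTop atTop) (hκ : Tendsto κ atTop (𝓝 l)) {z₀ : ℂ}
    (hz₀ : z₀ ∉ poles γ) (hl : 1 - (l : ℂ) * kernelHat c γ z₀ ≠ 0) :
    ∃ δ > 0, ∀ᶠ p : ℕ × ℂ in atTop ×ˢ 𝓝 z₀,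
      δ * s p.1 ≤ ‖scalarSymbol c γ (s p.1) (κ p.1) p.2‖ := by
  have hK := (h.differentiableAt hz₀).continuousAt.tendsto
  have hsC : Tendsto (fun n => ((s n)⁻¹ : ℂ)) atTop (𝓝 0) := by
    have := (Complex.continuous_ofReal.tendsto 0).comp (tendsto_inv_atTop_zero.comp hs)
    simpa [Function.comp_def] using this
  have hκC : Tendsto (fun n => (κ n : ℂ)) atTop (𝓝 l) :=
    (Complex.continuous_ofReal.tendsto l).comp hκ
  have hlim : Tendsto (fun p : ℕ × ℂ => p.2 ^ 2 * ((s p.1)⁻¹ : ℂ) +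
      (1 - κ p.1 * kernelHat c γ p.2)) (atTop ×ˢ 𝓝 z₀)
      (𝓝 (z₀ ^ 2 * 0 + (1 - l * kernelHat c γ z₀))) :=
    ((tendsto_snd.pow 2).mul (hsC.comp tendsto_fst)).add
      (tendsto_const_nhds.sub ((hκC.comp tendsto_fst).mul (hK.comp tendsto_snd)))
  rw [mul_zero, zero_add] at hlim
  have hpos := norm_pos_iff.2 hl
  refine ⟨_, half_pos hpos, ?_⟩
  filter_upwards [hlim.norm.eventually (lt_mem_nhds (half_lt_self hpos)),
    tendsto_fst.eventually (hs.eventually_gt_atTop 0)] with p hp hp0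
  have hp0' : (s p.1 : ℂ) ≠ 0 := by exact_mod_cast hp0.ne'
  have : scalarSymbol c γ (s p.1) (κ p.1) p.2 = (p.2 ^ 2 * ((s p.1)⁻¹ : ℂ) +
      (1 - κ p.1 * kernelHat c γ p.2)) * s p.1 := by
    rw [scalarSymbol]
    field_simp
  rw [this, norm_mul, Complex.norm_of_nonneg hp0.le]
  exact mul_le_mul_of_nonneg_right hp.le hp0.le

theorem IsAdmissible.exists_scalarSymbol_ge {c γ : ℕ → ℝ} (h : IsAdmissible c γ)
    {s κ : ℕ → ℝ} {l : ℝ} (hs0 : ∀ n, 0 < s n) (hs : Tendsto s atTop atTop)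
    (hκ : Tendsto κ atTop (𝓝 l)) {z₀ : ℂ} (hz₀ : z₀ ∉ poles γ)
    (hl : 1 - (l : ℂ) * kernelHat c γ z₀ ≠ 0)
    (hne : ∀ n, scalarSymbol c γ (s n) (κ n) z₀ ≠ 0) :
    ∃ δ > 0, ∀ n, δ * s n ≤ ‖scalarSymbol c γ (s n) (κ n) z₀‖ := by
  obtain ⟨d, hd, hev⟩ := h.eventually_scalarSymbol_ge hs hκ hz₀ hl
  obtain ⟨δ, hδ, hle⟩ := exists_pos_forall_le
    (u := fun n => ‖scalarSymbol c γ (s n) (κ n) z₀‖ / s n) hd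
    (fun n => div_pos (norm_pos_iff.2 (hne n)) (hs0 n)) (by
      filter_upwards [hev.curry] with n hn
      rw [le_div_iff₀ (hs0 n)]
      exact hn.self_of_nhds)
  exact ⟨δ, hδ, fun n => (le_div_iff₀ (hs0 n)).1 (hle n)⟩

/-- The uniform lower bound excludes nearby zeros for large n; the finitely many remaining symbols
are nonzero near z₀ by continuity. -/
theorem IsAdmissible.notMem_closure_zeros {c γ : ℕ → ℝ} (h : IsAdmissible c γ)
    {s κ : ℕ → ℝ} {l : ℝ} (hs0 : ∀ n, 0 < s n) (hs : Tendsto s atTop atTop)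
    (hκ : Tendsto κ atTop (𝓝 l)) {z₀ : ℂ} (hz₀ : z₀ ∉ poles γ)
    (hl : 1 - (l : ℂ) * kernelHat c γ z₀ ≠ 0)
    (hne : ∀ n, scalarSymbol c γ (s n) (κ n) z₀ ≠ 0) :
    z₀ ∉ closure (⋃ n, scalarZeros c γ (s n) (κ n)) := by
  obtain ⟨d, hd, hev⟩ := h.eventually_scalarSymbol_ge hs hκ hz₀ hl
  obtain ⟨p, hp, q, hq, hpq⟩ := eventually_prod_iff.1 hev
  obtain ⟨N, hN⟩ := eventually_atTop.1 hp
  have hfin : ∀ᶠ z in 𝓝 z₀, ∀ n ∈ Finset.range N, scalarSymbol c γ (s n) (κ n) z ≠ 0 := by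
    rw [Filter.eventually_all_finset]
    intro n _
    have hc : ContinuousAt (scalarSymbol c γ (s n) (κ n)) z₀ := by
      have := (h.differentiableAt hz₀).continuousAt
      unfold scalarSymbol
      fun_prop
    exact hc.eventually_ne (hne n)
  rw [mem_closure_iff_frequently, not_frequently]
  filter_upwards [hq, hfin] with z hz1 hz2 hz
  obtain ⟨n, hn⟩ := Set.mem_iUnion.1 hz
  rcases lt_or_ge n N with hnN | hnN
  · exact hz2 n (Finset.mem_range.2 hnN) hn.2
  · have h1 := hpq (hN n hnN) hz1
    simp only [hn.2, norm_zero] at h1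
    have := mul_pos hd (hs0 n)
    linarith

theorem IsAdmissible.pole_notMem_closure_zeros {c γ : ℕ → ℝ} (h : IsAdmissible c γ)
    (hc : ∀ k, 0 < c k) {s : ℕ → ℝ} (hs : ∀ n, 1 ≤ s n) {z₀ : ℂ} (hz₀ : z₀ ∈ poles γ) :
    z₀ ∉ closure (⋃ n, scalarZeros c γ (s n) 1) := by
  obtain ⟨k, rfl⟩ := hz₀
  -- At a zero with |z| < γₖ + 1, |K̂| = |1 + z²/s| is at most this threshold, as s ≥ 1.
  have h1 := (h.tendsto_norm_kernelHat (hc k)).eventually_gt_atTop (1 + (γ k + 1) ^ 2)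
  rw [eventually_nhdsWithin_iff] at h1
  have h2 : ∀ᶠ z : ℂ in 𝓝 (-(γ k : ℂ)), ‖z‖ < γ k + 1 := by
    refine (continuous_norm.tendsto _).eventually (gt_mem_nhds ?_)
    rw [norm_neg, Complex.norm_of_nonneg (h.pos k).le]
    exact lt_add_one _
  rw [mem_closure_iff_frequently, not_frequently]
  filter_upwards [h1, h2] with z hz1 hz2 hz
  obtain ⟨n, hnp, hn⟩ := Set.mem_iUnion.1 hz
  have hz3 := hz1 fun he => hnp ⟨k, he.symm⟩
  have hs0 : 0 < s n := zero_lt_one.trans_le (hs n)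
  have hs' : (s n : ℂ) ≠ 0 := by exact_mod_cast hs0.ne'
  have hK : kernelHat c γ z = 1 + z ^ 2 / s n := by
    rw [scalarSymbol, Complex.ofReal_one, one_mul] at hn
    field_simp
    linear_combination -hn
  have h4 : ‖kernelHat c γ z‖ ≤ 1 + ‖z‖ ^ 2 := by
    rw [hK]
    refine (norm_add_le _ _).trans ?_
    rw [norm_one, norm_div, norm_pow, Complex.norm_of_nonneg hs0.le]
    gcongr
    exact div_le_self (by positivity) (hs n)
  have h5 : ‖z‖ ^ 2 ≤ (γ k + 1) ^ 2 := by gcongr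
  linarith

theorem IsAdmissible.kernelReal_lt_of_gap {c γ : ℕ → ℝ} (h : IsAdmissible c γ) (hc : 0 < c 0)
    {x y : ℝ} {k : ℕ} (hx1 : -γ k < x) (hy2 : ∀ j < k, y < -γ j) (hxy : x < y) :
    kernelReal c γ y < kernelReal c γ x := by
  have hx2 : ∀ j < k, x < -γ j := fun j hj => hxy.trans (hy2 j hj)
  have hy1 := hx1.trans hxy
  have hx := h.add_ne_zero_of_gap hx1 hx2
  have hy := h.add_ne_zero_of_gap hy1 hy2
  have hdiff : ∀ j, c j / (x + γ j) - c j / (y + γ j) =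
      c j * (y - x) / ((x + γ j) * (y + γ j)) := fun j => by
    have := hx j
    have := hy j
    field_simp
    ring
  have hpos := h.mul_pos_of_gap hx1 hx2 hy1 hy2
  refine hasSum_lt (i := 0) (fun j => ?_) ?_ (h.hasSum_real hy) (h.hasSum_real hx)
  · rw [← sub_nonneg, hdiff]
    exact div_nonneg (mul_nonneg (h.nonneg j) (sub_pos.2 hxy).le) (hpos j).le
  · rw [← sub_pos, hdiff]
    exact div_pos (mul_pos hc (sub_pos.2 hxy)) (hpos 0)

/-- Im K̂(z) = -Im z · ∑ cₖ/|z + γₖ|², and the sum is positive. -/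
theorem IsAdmissible.im_eq_zero_of_kernelHat_eq_one {c γ : ℕ → ℝ} (h : IsAdmissible c γ)
    (hc : 0 < c 0) {z : ℂ} (hz : z ∉ poles γ) (h1 : kernelHat c γ z = 1) : z.im = 0 := by
  by_contra him
  have h2 := Complex.hasSum_im (h.hasSum hz)
  rw [h1, Complex.one_im] at h2
  have hterm : ∀ k, ((c k : ℂ) / (z + γ k)).im = -z.im * (c k / Complex.normSq (z + γ k)) := by
    intro k
    rw [Complex.div_im]
    simp
    ring
  simp only [hterm] at h2
  have h3 := h2.mul_left (-z.im)⁻¹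
  simp only [inv_mul_cancel_left₀ (neg_ne_zero.2 him), mul_zero] at h3
  have h4 := (hasSum_zero_iff_of_nonneg fun k =>
    div_nonneg (h.nonneg k) (Complex.normSq_nonneg _)).1 h3
  exact (div_pos hc (Complex.normSq_pos.2 (notMem_poles.1 hz 0))).ne' (congrFun h4 0)

/-- The zeros of `1 - K̂` are limits of zeros of the functions `z² + s n (1 - K̂(z))`. -/
theorem IsAdmissible.mem_closure_zeros {c γ : ℕ → ℝ} (h : IsAdmissible c γ) (hc : 0 < c 0)
    {s : ℕ → ℝ} (hs : Tendsto s atTop atTop) {z : ℂ} (hz : z ∉ poles γ)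
    (h1 : kernelHat c γ z = 1) : z ∈ closure (⋃ n, scalarZeros c γ (s n) 1) := by
  obtain ⟨x, rfl⟩ : ∃ x : ℝ, z = x := ⟨z.re, Complex.ext (by simp)
    (by simpa using h.im_eq_zero_of_kernelHat_eq_one hc hz h1)⟩
  rw [kernelHat_ofReal, Complex.ofReal_eq_one] at h1
  obtain ⟨k, hk1, hk2⟩ := h.gap_cases (ofReal_notMem_poles.1 hz)
  rw [Metric.mem_closure_iff]
  intro ε hε
  obtain ⟨r, hr0, hrε, hr1, hr2⟩ : ∃ r > 0, r < ε ∧ -γ k < x - r ∧ ∀ j < k, x + r < -γ j := by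
    have e1 : ∀ᶠ r in 𝓝[>] (0 : ℝ), r < ε := (gt_mem_nhds hε).filter_mono nhdsWithin_le_nhds
    have e2 : ∀ᶠ r in 𝓝[>] (0 : ℝ), r < x + γ k :=
      (gt_mem_nhds (by linarith)).filter_mono nhdsWithin_le_nhds
    have e3 : ∀ᶠ r in 𝓝[>] (0 : ℝ), ∀ j ∈ Finset.range k, r < -γ j - x := by
      rw [Filter.eventually_all_finset]
      intro j hj
      exact (gt_mem_nhds (by linarith [hk2 j (Finset.mem_range.1 hj)])).filter_mono
        nhdsWithin_le_nhds
    obtain ⟨r, h1, h2, h3, h4⟩ := (e1.and (e2.and (e3.and self_mem_nhdsWithin))).exists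
    exact ⟨r, h4, h1, by linarith, fun j hj => by linarith [h3 j (Finset.mem_range.2 hj)]⟩
  have hK1 : 1 < kernelReal c γ (x - r) := by
    rw [← h1]
    exact h.kernelReal_lt_of_gap hc hr1 hk2 (by linarith)
  have hK2 : kernelReal c γ (x + r) < 1 := by
    rw [← h1]
    exact h.kernelReal_lt_of_gap hc hk1 hr2 (by linarith)
  -- Since K̂ - 1 changes sign strictly at x, a large s makes the symbol negative at x - r in spite
  -- of the square; at x + r it is positive anyway.
  obtain ⟨n, hn1, hn0⟩ := ((hs.eventually_gt_atTop
    ((x - r) ^ 2 / (kernelReal c γ (x - r) - 1))).and (hs.eventually_gt_atTop 0)).exists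
  rw [div_lt_iff₀ (by linarith)] at hn1
  have hgap : ∀ y ∈ Set.Icc (x - r) (x + r), ∀ j, y + γ j ≠ 0 := fun y hy =>
    h.add_ne_zero_of_gap (hr1.trans_le hy.1) fun j hj => hy.2.trans_lt (hr2 j hj)
  have hcont : ContinuousOn (fun y => y ^ 2 + s n * (1 - 1 * kernelReal c γ y))
      (Set.Icc (x - r) (x + r)) := by
    intro y hy
    have := (h.continuousAt_real fun j => Or.inr (hgap y hy j)).continuousWithinAt
      (s := Set.Icc (x - r) (x + r))
    fun_prop
  obtain ⟨y, hy, hy0⟩ := intermediate_value_Icc (by linarith) hcont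
    (show (0 : ℝ) ∈ Set.Icc _ _ from ⟨by linarith, by
      have := mul_pos hn0 (sub_pos.2 hK2)
      have := sq_nonneg (x + r)
      linarith⟩)
  refine ⟨y, Set.mem_iUnion.2 ⟨n, ofReal_notMem_poles.2 (hgap y hy), ?_⟩, ?_⟩
  · rw [scalarSymbol_ofReal]
    exact_mod_cast hy0
  · rw [dist_eq_norm, ← Complex.ofReal_sub, Complex.norm_real, Real.norm_eq_abs]
    exact (abs_le.2 ⟨by linarith [hy.2], by linarith [hy.1]⟩).trans_lt hrε

/-! ### Application to ℓₙ and L -/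

theorem ellZeros_eq (a c γ : ℕ → ℝ) (θ : ℝ) (n : ℕ) :
    ellZeros a c γ θ n = scalarZeros c γ (a n ^ 2) (1 / a n ^ (2 * (1 - θ))) := by
  simp [ellZeros, scalarZeros, ell, scalarSymbol]

theorem ell_eq_scalarSymbol (a c γ : ℕ → ℝ) (θ : ℝ) (n : ℕ) (z : ℂ) :
    ell a c γ θ n z = scalarSymbol c γ (a n ^ 2) (1 / a n ^ (2 * (1 - θ))) z := by
  simp [ell, scalarSymbol]

theorem tendsto_of_isBigO_rpow {γ : ℕ → ℝ} {B β : ℝ} (hB : 0 < B) (hβ : 0 < β)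
    (hγ : (fun k : ℕ => γ k - B * ((k : ℝ) + 1) ^ β) =O[atTop]
      fun k : ℕ => ((k : ℝ) + 1) ^ (β - 1)) : Tendsto γ atTop atTop := by
  have hk : Tendsto (fun k : ℕ => (k : ℝ) + 1) atTop atTop :=
    tendsto_atTop_add_const_right _ _ tendsto_natCast_atTop_atTop
  have ho : (fun k : ℕ => ((k : ℝ) + 1) ^ (β - 1)) =o[atTop]
      fun k : ℕ => B * ((k : ℝ) + 1) ^ β := by
    have h1 : (fun k : ℕ => ((k : ℝ) + 1)⁻¹) =o[atTop] fun _ : ℕ => B :=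
      (Asymptotics.isLittleO_const_iff hB.ne').2 (tendsto_inv_atTop_zero.comp hk)
    refine (h1.mul_isBigO (Asymptotics.isBigO_refl
      (fun k : ℕ => ((k : ℝ) + 1) ^ β) atTop)).congr_left fun k => ?_
    rw [Real.rpow_sub_one (by positivity), div_eq_inv_mul]
  have he : Asymptotics.IsEquivalent atTop γ fun k : ℕ => B * ((k : ℝ) + 1) ^ β :=
    hγ.trans_isLittleO ho
  exact he.symm.tendsto_atTop (((tendsto_rpow_atTop hβ).comp hk).const_mul_atTop hB)

end GurtinPipkin

/-- Sequences are indexed from `0`: `a n`, `e n`, `c k`, `γ k`, `x n k` stand for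
`aₙ₊₁`, `eₙ₊₁`, `cₖ₊₁`, `γₖ₊₁`, `λₙ₊₁,ₖ₊₁`. -/
theorem mainTheorem6 {H : Type*} [NormedAddCommGroup H] [InnerProductSpace ℂ H] [CompleteSpace H]
    -- a positive self-adjoint operator with compact inverse
    (A : H →ₗ.[ℂ] H) (hA : IsSelfAdjoint A)
    (hApos : ∀ x : A.domain, (x : H) ≠ 0 → 0 < (inner ℂ (A x) (x : H)).re)
    (hAinv : ∃ T : H →L[ℂ] H, IsCompactOperator T ∧ GurtinPipkin.IsBoundedInverse A T)
    -- its orthonormal eigenbasis and its eigenvalues in increasing order, with multiplicity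
    (e : HilbertBasis ℕ ℂ H) (a : ℕ → ℝ)
    (he : ∀ n, ∃ h : e n ∈ A.domain, A ⟨e n, h⟩ = (a n : ℂ) • e n)
    (hamono : Monotone a) (ha1 : 1 ≤ a 0)
    -- the exponent and the kernel
    (θ : ℝ) (hθ : θ ∈ Set.Icc (0 : ℝ) 1)
    (c γ : ℕ → ℝ) (hc : ∀ k, 0 < c k) (hγ0 : ∀ k, 0 < γ k) (hγ : StrictMono γ)
    (hsum : Summable fun k => c k / γ k) (hsum1 : ∑' k, c k / γ k < 1)
    -- the power-like behaviour of the coefficients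
    (A₀ B₀ α β : ℝ) (hA₀ : 0 < A₀) (hB₀ : 0 < B₀) (hα0 : 0 < α) (hα1 : α ≤ 1)
    (hαβ : 1 < α + β) (hβ : 1 / 2 < β)
    (hcas : (fun k : ℕ => c k - A₀ / ((k : ℝ) + 1) ^ α) =O[atTop]
      fun k : ℕ => 1 / ((k : ℝ) + 1) ^ (α + 1))
    (hγas : (fun k : ℕ => γ k - B₀ * ((k : ℝ) + 1) ^ β) =O[atTop]
      fun k : ℕ => ((k : ℝ) + 1) ^ (β - 1)) :
    ∃ (x : ℕ → ℕ → ℝ) (zp zm : ℕ → ℂ),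
      -- the zeros of `ℓₙ` are the interlacing real zeros `x n k` and a pair `zp n`, `zm n`
      (∀ n, -γ 0 < x n 0 ∧ x n 0 < 0) ∧
      (∀ n k, -γ (k + 1) < x n (k + 1) ∧ x n (k + 1) < -γ k) ∧
      (θ < 1 → ∀ k, Tendsto (fun n => x n k) atTop (𝓝 (-γ k))) ∧
      (∀ n, GurtinPipkin.ellZeros a c γ θ n =
        Set.range (fun k => ((x n k : ℝ) : ℂ)) ∪ {zp n, zm n}) ∧
      (∀ᶠ n in atTop, 0 < (zp n).im ∧ zm n = (starRingEnd ℂ) (zp n)) ∧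
      -- the spectrum
      (θ < 1 → GurtinPipkin.symbolSpectrum A e a c γ θ =
        closure ((⋃ n, ⋃ k, {((x n k : ℝ) : ℂ)}) ∪ ⋃ n, {zp n, zm n})) ∧
      (θ = 1 → GurtinPipkin.symbolSpectrum A e a c γ θ \ GurtinPipkin.poles γ =
        closure ((⋃ n, ⋃ k, {((x n k : ℝ) : ℂ)}) ∪ ⋃ n, {zp n, zm n})) := by
  obtain ⟨T, hTc, hT⟩ := hAinv
  have ha : ∀ n, 1 ≤ a n := fun n => ha1.trans (hamono (Nat.zero_le n))
  have ha0 : ∀ n, 0 < a n := fun n => zero_lt_one.trans_le (ha n)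
  have hat : Tendsto a atTop atTop := GurtinPipkin.tendsto_eigenvalues he ha hT hTc hamono
  have h : GurtinPipkin.IsAdmissible c γ := ⟨fun k => (hc k).le, hγ0, hγ,
    GurtinPipkin.tendsto_of_isBigO_rpow hB₀ (by linarith) hγas, hsum⟩
  have hs0 : ∀ n, 0 < a n ^ 2 := fun n => pow_pos (ha0 n) 2
  have hs : Tendsto (fun n => a n ^ 2) atTop atTop := (tendsto_pow_atTop two_ne_zero).comp hat
  have hκ0 : ∀ n, 0 < 1 / a n ^ (2 * (1 - θ)) := fun n =>
    one_div_pos.2 (Real.rpow_pos_of_pos (ha0 n) _)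
  have hκ1 : ∀ n, 1 / a n ^ (2 * (1 - θ)) ≤ 1 := fun n =>
    (div_le_one (Real.rpow_pos_of_pos (ha0 n) _)).2
      (Real.one_le_rpow (ha n) (by linarith [hθ.2]))
  have hκlt : θ < 1 → Tendsto (fun n => 1 / a n ^ (2 * (1 - θ))) atTop (𝓝 0) := fun hlt =>
    tendsto_const_nhds.div_atTop ((tendsto_rpow_atTop (by linarith)).comp hat)
  choose x zp zm hx hzeros him using fun n =>
    h.scalarZeros_structure hc hsum1 (hs0 n) (hκ0 n) (hκ1 n)
  have hxmem : ∀ n k, (x n k : ℂ) ∈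
      GurtinPipkin.scalarZeros c γ (a n ^ 2) (1 / a n ^ (2 * (1 - θ))) := fun n k => by
    rw [hzeros n]
    exact Or.inl ⟨k, rfl⟩
  have hlim : θ < 1 → ∀ k, Tendsto (fun n => x n k) atTop (𝓝 (-γ k)) := fun hlt k =>
    h.tendsto_zero_of_gap hs0 hκ0 (hκlt hlt) (fun n => (hx n k).1) (fun n => (hx n k).2.1)
      fun n => hxmem n k
  have hunion : (⋃ n, ⋃ k, {((x n k : ℝ) : ℂ)}) ∪ ⋃ n, {zp n, zm n} =
      ⋃ n, GurtinPipkin.scalarZeros c γ (a n ^ 2) (1 / a n ^ (2 * (1 - θ))) := by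
    rw [← Set.iUnion_union_distrib]
    exact Set.iUnion_congr fun n => by rw [hzeros n, Set.iUnion_singleton_eq_range]
  have hnotres : ∀ {z n},
      z ∈ GurtinPipkin.scalarZeros c γ (a n ^ 2) (1 / a n ^ (2 * (1 - θ))) →
      z ∉ GurtinPipkin.symbolResolventSet A e a c γ θ := fun {z n} hz =>
    GurtinPipkin.notMem_symbolResolventSet_of_ell he ha hT hθ.2
      ((GurtinPipkin.ell_eq_scalarSymbol a c γ θ n z).trans hz.2)
  -- away from the poles, the zeros and the zeros of the limit function the symbol is invertible
  have hres : ∀ {l : ℝ} {z : ℂ}, Tendsto (fun n => 1 / a n ^ (2 * (1 - θ))) atTop (𝓝 l) →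
      z ∉ GurtinPipkin.poles γ → 1 - (l : ℂ) * GurtinPipkin.kernelHat c γ z ≠ 0 →
      z ∉ ⋃ n, GurtinPipkin.scalarZeros c γ (a n ^ 2) (1 / a n ^ (2 * (1 - θ))) →
      z ∈ GurtinPipkin.symbolResolventSet A e a c γ θ := by
    intro l z hl hz hD hne
    obtain ⟨δ, hδ, hle⟩ := h.exists_scalarSymbol_ge hs0 hs hl hz hD fun n hn =>
      hne (Set.mem_iUnion.2 ⟨n, hz, hn⟩)
    refine GurtinPipkin.mem_symbolResolventSet he ha hT hθ.2 hz hδ fun n => ?_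
    rw [GurtinPipkin.ell_eq_scalarSymbol]
    exact hle n
  have hclosed : ∀ {l : ℝ} {z : ℂ}, Tendsto (fun n => 1 / a n ^ (2 * (1 - θ))) atTop (𝓝 l) →
      z ∈ GurtinPipkin.symbolResolventSet A e a c γ θ →
      1 - (l : ℂ) * GurtinPipkin.kernelHat c γ z ≠ 0 →
      z ∉ closure (⋃ n, GurtinPipkin.scalarZeros c γ (a n ^ 2) (1 / a n ^ (2 * (1 - θ)))) :=
    fun {l z} hl hz hD => h.notMem_closure_zeros hs0 hs hl hz.1 hD fun _ hn =>
      hnotres ⟨hz.1, hn⟩ hz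
  refine ⟨x, zp, zm, fun n => ⟨(hx n 0).1, (hx n 0).2.2⟩,
    fun n k => ⟨(hx n (k + 1)).1, (hx n (k + 1)).2.1 k (Nat.lt_succ_self k)⟩, hlim,
    fun n => (GurtinPipkin.ellZeros_eq a c γ θ n).trans (hzeros n), ?_, fun hlt => ?_,
    fun heq => ?_⟩
  · filter_upwards [hat.eventually h.eventually_exists_nonreal_zero] with n hn
    exact him n (hn _ ⟨(hκ0 n).le, hκ1 n⟩)
  · rw [hunion]
    have hD : ∀ z, 1 - ((0 : ℝ) : ℂ) * GurtinPipkin.kernelHat c γ z ≠ 0 := by simp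
    refine Set.Subset.antisymm (fun z hz => ?_) fun z hz hzr =>
      hclosed (hκlt hlt) hzr (hD z) hz
    by_cases hzp : z ∈ GurtinPipkin.poles γ
    · obtain ⟨k, rfl⟩ := hzp
      have hxC : Tendsto (fun n => (x n k : ℂ)) atTop (𝓝 (-(γ k : ℂ))) := by
        simpa [Function.comp_def] using
          (Complex.continuous_ofReal.tendsto (-γ k)).comp (hlim hlt k)
      exact mem_closure_of_tendsto hxC
        (Eventually.of_forall fun n => Set.mem_iUnion.2 ⟨n, hxmem n k⟩)
    · by_contra hcl
      exact hz (hres (hκlt hlt) hzp (hD z) fun hzz => hcl (subset_closure hzz))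
  · rw [hunion]
    have hκeq : ∀ n, 1 / a n ^ (2 * (1 - θ)) = 1 := fun n => by simp [heq]
    have hκlim : Tendsto (fun n => 1 / a n ^ (2 * (1 - θ))) atTop (𝓝 1) := by
      simp only [hκeq]
      exact tendsto_const_nhds
    refine Set.Subset.antisymm (fun z hz => ?_) fun z hz => ⟨fun hzr => ?_, fun hzp => ?_⟩
    · by_contra hcl
      by_cases hD : 1 - ((1 : ℝ) : ℂ) * GurtinPipkin.kernelHat c γ z = 0
      · rw [Complex.ofReal_one, one_mul, sub_eq_zero] at hD
        simp only [hκeq] at hcl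
        exact hcl (h.mem_closure_zeros (hc 0) hs hz.2 hD.symm)
      · exact hz.1 (hres hκlim hz.2 hD fun hzz => hcl (subset_closure hzz))
    · by_cases hD : 1 - ((1 : ℝ) : ℂ) * GurtinPipkin.kernelHat c γ z = 0
      -- Where K̂(z) = 1, every ℓₙ(z) equals z².
      · refine GurtinPipkin.notMem_symbolResolventSet_of_const he ha hT hat (ω := z ^ 2)
          (fun n => ?_) hzr
        rw [GurtinPipkin.ell_eq_scalarSymbol, hκeq, GurtinPipkin.scalarSymbol, hD, mul_zero,
          add_zero]
      · exact hclosed hκlim hzr hD hz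
    · simp only [hκeq] at hz
      exact h.pole_notMem_closure_zeros hc (fun n => one_le_pow₀ (ha n)) hzp hz
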